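/- Let $\Omega$ be a compact metrizable space with a continuous action $\alpha$ of $\mathbb R^d$, and let $\omega_0\in\Omega$ have dense orbit. Let $\mathcal C$ be the $C^*$-algebra of all functions $q\mapsto f(\alpha_q^{-1}(\omega_0))$ on $\mathbb R^d$ with $f\in C(\Omega)$, equipped with the translation action $\tilde\alpha_x(f)(q)=f(q+x)$. Let $(B_\omega)_{\omega\in\Omega}$ be a configuration dependent magnetic field: $B_\omega(p)=b(\alpha_p^{-1}(\omega))$ for a continuous map $b$ from $\Omega$ to the alternating $2$-forms on $\mathbb R^d$, each $B_\omega$ being a closed $2$-form (in the integrated sense: zero net flux through the boundary of every tetrahedron). Let $\tilde\sigma(x,y)(q)=\exp(-i\Phi(q,q+x,q+x+y))$, where $\Phi(a,b,c)$ is the flux of $B_{\omega_0}$ through the oriented triangle with corners $a,b,c$; this is a $2$-cocycle with values in the unitaries of $\mathcal C$. Let $\mathcal C\rtimes_{\tilde\alpha,\tilde\sigma}\mathbb R^d$ be the twisted crossed product, i.e. the completion, in the universal $C^*$-norm (the largest $C^*$-seminorm dominated by the $L^1$-norm), of $C_c(\mathbb R^d,\mathcal C)$ with product $(F*G)(x)=\int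 F(y)\,\tilde\alpha_y(G(x-y))\,\tilde\sigma(y,x-y)\,dy$ and involution $F^*(x)=\tilde\alpha_x(F(-x))^*$. Let $A$ be a continuous $1$-form on $\mathbb R^d$ with $dA=B_{\omega_0}$ in the sense of distributions (a continuous vector potential), and put $$\lambda(x)(q)=\exp\Big(-i\int_{[q,q+x]}A\Big),$$ so that $\tilde\sigma(x,y)=\lambda(x)\,\tilde\alpha_x(\lambda(y))\,\lambda(x+y)^{-1}$. For $F\in C_c(\mathbb R^d,\mathcal C)$ define $\mathfrak f(F)(z)(q)=\overline{F(z)(q)}\,\lambda(z)(q)^{-2}$. **Theorem.** (1) $\mathfrak f$ defines a real structure on $\mathcal C\rtimes_{\tilde\alpha,\tilde\sigma}\mathbb R^d$ (that is, $\mathfrak f$ maps $C_c(\mathbb R^d,\mathcal C)$ to itself and extends to a norm preserving anti-linear $*$-automorphism of order two of the crossed product) if and only if $\lambda(z)\in\mathcal C$ for all $z\in\mathbb R^d$. (2) The components of $A$ belong to $\mathcal C$ if and only if $A$ is uniformly continuous and $\lambda(z)\in\mathcal C$ for all $z\in\mathbb R^d$. In particular, if $A$ is uniformly continuous, then the conditions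 in (1) are equivalent to the components of $A$ belonging to $\mathcal C$. -/

import Mathlib

open MeasureTheory
open scoped CompactlySupported BoundedContinuousFunction

set_option linter.unusedSectionVars false

noncomputable section

/-- Euclidean space `ℝ^d`. -/
abbrev Euc (d : ℕ) : Type := EuclideanSpace ℝ (Fin d)

/-- A twisted action of `ℝ^d` on a commutative unital `C*`-algebra: a strongly continuous action `α`
by `*`-automorphisms together with a norm-continuous, unitary, normalised `2`-cocycle `σ`.
The condition `σ(x, -x) = 1` holds for cocycles given by fluxes through triangles; it is what makes
`F^*(x) = α_x(F(-x))^*` an involution, with no correction by `σ`. -/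
structure TwistedSystem (d : ℕ) (𝒜 : Type*) [CommCStarAlgebra 𝒜] where
  act : Euc d → 𝒜 →⋆ₐ[ℂ] 𝒜
  act_zero : ∀ f, act 0 f = f
  act_add : ∀ x y f, act (x + y) f = act x (act y f)
  continuous_act : ∀ f, Continuous fun x => act x f
  cocycle : Euc d → Euc d → 𝒜
  continuous_cocycle : Continuous fun p : Euc d × Euc d => cocycle p.1 p.2
  cocycle_unitary : ∀ x y, cocycle x y ∈ unitary 𝒜
  cocycle_mul : ∀ x y z,
    cocycle x y * cocycle (x + y) z = act x (cocycle y z) * cocycle x (y + z)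
  cocycle_zero_left : ∀ x, cocycle 0 x = 1
  cocycle_zero_right : ∀ x, cocycle x 0 = 1
  cocycle_neg : ∀ x, cocycle x (-x) = 1

namespace TwistedSystem

variable {d : ℕ} {𝒜 : Type*} [CommCStarAlgebra 𝒜] (S : TwistedSystem d 𝒜)

theorem norm_act_le (x : Euc d) (f : 𝒜) : ‖S.act x f‖ ≤ ‖f‖ :=
  NonUnitalStarAlgHom.norm_apply_le (S.act x) f

theorem continuous_act_uncurry : Continuous fun p : Euc d × 𝒜 => S.act p.1 p.2 := by
  rw [continuous_iff_continuousAt]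
  rintro ⟨x₀, f₀⟩
  rw [ContinuousAt, tendsto_iff_norm_sub_tendsto_zero]
  have h1 : Filter.Tendsto (fun p : Euc d × 𝒜 => ‖p.2 - f₀‖ + ‖S.act p.1 f₀ - S.act x₀ f₀‖)
      (nhds (x₀, f₀)) (nhds 0) := by
    have hc : Continuous fun p : Euc d × 𝒜 => ‖p.2 - f₀‖ + ‖S.act p.1 f₀ - S.act x₀ f₀‖ :=
      (continuous_snd.sub continuous_const).norm.add
        ((((S.continuous_act f₀).comp continuous_fst).sub continuous_const).norm)
    have := hc.tendsto (x₀, f₀)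
    simpa using this
  refine squeeze_zero (fun _ => norm_nonneg _) (fun p => ?_) h1
  have : S.act p.1 p.2 - S.act x₀ f₀ = S.act p.1 (p.2 - f₀) + (S.act p.1 f₀ - S.act x₀ f₀) := by
    rw [map_sub]; abel
  rw [this]
  exact (norm_add_le _ _).trans (add_le_add (S.norm_act_le _ _) le_rfl)

theorem continuous_act_comp {X : Type*} [TopologicalSpace X] {u : X → Euc d} {v : X → 𝒜}
    (hu : Continuous u) (hv : Continuous v) : Continuous fun p => S.act (u p) (v p) :=
  S.continuous_act_uncurry.comp (hu.prodMk hv)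

theorem continuous_cocycle_comp {X : Type*} [TopologicalSpace X] {u v : X → Euc d}
    (hu : Continuous u) (hv : Continuous v) : Continuous fun p => S.cocycle (u p) (v p) :=
  S.continuous_cocycle.comp (hu.prodMk hv)

/-- The action as a continuous linear map. -/
def actL (x : Euc d) : 𝒜 →L[ℂ] 𝒜 :=
  LinearMap.mkContinuous ((S.act x).toAlgHom.toLinearMap) 1
    (fun f => by simpa using S.norm_act_le x f)

@[simp] theorem actL_apply (x : Euc d) (f : 𝒜) : S.actL x f = S.act x f := rfl

/-- The space `C_c(ℝ^d, 𝒜)`, which will carry the twisted convolution product. -/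
def ConvAlg (_S : TwistedSystem d 𝒜) : Type _ := C_c(Euc d, 𝒜)

namespace ConvAlg

instance : FunLike S.ConvAlg (Euc d) 𝒜 := inferInstanceAs (FunLike C_c(Euc d, 𝒜) (Euc d) 𝒜)
instance : AddCommGroup S.ConvAlg := inferInstanceAs (AddCommGroup C_c(Euc d, 𝒜))
instance : Module ℂ S.ConvAlg := inferInstanceAs (Module ℂ C_c(Euc d, 𝒜))

variable {S}

protected theorem continuous (F : S.ConvAlg) : Continuous F :=
  F.toContinuousMap.continuous
protected theorem hasCompactSupport (F : S.ConvAlg) : HasCompactSupport F :=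
  CompactlySupportedContinuousMap.hasCompactSupport' F
@[ext] theorem ext {F G : S.ConvAlg} (h : ∀ x, F x = G x) : F = G := DFunLike.ext F G h
@[simp] theorem add_apply (F G : S.ConvAlg) (x : Euc d) : (F + G) x = F x + G x := rfl
@[simp] theorem smul_apply (c : ℂ) (F : S.ConvAlg) (x : Euc d) : (c • F) x = c • F x := rfl
@[simp] theorem zero_apply (x : Euc d) : (0 : S.ConvAlg) x = 0 := rfl

/-- An element of `C_c(ℝ^d, 𝒜)` from its underlying function. -/
def mk (F : Euc d → 𝒜) (h : Continuous F) (h' : HasCompactSupport F) : S.ConvAlg :=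
  (⟨⟨F, h⟩, h'⟩ : C_c(Euc d, 𝒜))
@[simp] theorem mk_apply (F : Euc d → 𝒜) (h : Continuous F) (h' : HasCompactSupport F)
    (x : Euc d) : (mk F h h' : S.ConvAlg) x = F x := rfl

/-- The integrand of the twisted convolution. -/
def integrand (F G : S.ConvAlg) (x y : Euc d) : 𝒜 :=
  F y * S.act y (G (x - y)) * S.cocycle y (x - y)

theorem continuous_integrand {X : Type*} [TopologicalSpace X] (F G : S.ConvAlg)
    {u v : X → Euc d} (hu : Continuous u) (hv : Continuous v) :
    Continuous fun p => integrand F G (u p) (v p) :=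
  ((F.continuous.comp hv).mul (S.continuous_act_comp hv (G.continuous.comp (hu.sub hv)))).mul
    (S.continuous_cocycle_comp hv (hu.sub hv))

theorem hasCompactSupport_integrand (F G : S.ConvAlg) (x : Euc d) :
    HasCompactSupport (integrand F G x) :=
  (F.hasCompactSupport.mul_right).mul_right

theorem integrable_integrand (F G : S.ConvAlg) (x : Euc d) :
    Integrable (integrand F G x) :=
  (continuous_integrand F G continuous_const continuous_id).integrable_of_hasCompactSupport
    (hasCompactSupport_integrand F G x)

theorem setIntegral_integrand (F G : S.ConvAlg) (x : Euc d) :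
    ∫ y in tsupport F, integrand F G x y = ∫ y, integrand F G x y := by
  refine setIntegral_eq_integral_of_forall_compl_eq_zero (fun y hy => ?_)
  simp [integrand, image_eq_zero_of_notMem_tsupport hy]

theorem continuous_conv (F G : S.ConvAlg) : Continuous fun x => ∫ y, integrand F G x y := by
  simp_rw [← setIntegral_integrand]
  exact continuous_parametric_integral_of_continuous
    (continuous_integrand F G continuous_fst continuous_snd) F.hasCompactSupport

theorem hasCompactSupport_conv (F G : S.ConvAlg) :
    HasCompactSupport fun x => ∫ y, integrand F G x y := by
  refine HasCompactSupport.intro (F.hasCompactSupport.isCompact.add G.hasCompactSupport.isCompact)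
    (fun x hx => ?_)
  refine integral_eq_zero_of_ae (Filter.Eventually.of_forall fun y => ?_)
  by_cases hy : y ∈ tsupport F
  · have : x - y ∉ tsupport G := fun h => hx ⟨y, hy, x - y, h, by simp⟩
    simp [integrand, image_eq_zero_of_notMem_tsupport this]
  · simp [integrand, image_eq_zero_of_notMem_tsupport hy]

/-- The twisted convolution `(F * G)(x) = ∫ F(y) α_y(G(x - y)) σ(y, x - y) dy`. -/
instance : Mul S.ConvAlg :=
  ⟨fun F G => mk (fun x => ∫ y, F y * S.act y (G (x - y)) * S.cocycle y (x - y))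
    (continuous_conv F G) (hasCompactSupport_conv F G)⟩

theorem mul_apply (F G : S.ConvAlg) (x : Euc d) : (F * G) x = ∫ y, integrand F G x y := rfl

theorem continuous_star' (F : S.ConvAlg) : Continuous fun x => star (S.act x (F (-x))) :=
  (S.continuous_act_comp continuous_id (F.continuous.comp continuous_neg)).star

theorem hasCompactSupport_star' (F : S.ConvAlg) :
    HasCompactSupport fun x => star (S.act x (F (-x))) := by
  refine HasCompactSupport.intro (F.hasCompactSupport.isCompact.neg) (fun x hx => ?_)
  have : -x ∉ tsupport F := fun h => hx (by simpa using h)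
  simp [image_eq_zero_of_notMem_tsupport this]

/-- The involution `F^*(x) = α_x(F(-x))^*`. -/
instance : Star S.ConvAlg :=
  ⟨fun F => mk (fun x => star (S.act x (F (-x)))) (continuous_star' F)
    (hasCompactSupport_star' F)⟩

theorem star_apply (F : S.ConvAlg) (x : Euc d) : (star F) x = star (S.act x (F (-x))) := rfl

theorem mul_assoc' (F G H : S.ConvAlg) : F * G * H = F * (G * H) := by
  ext x
  have hL : (F * G * H) x = ∫ y, ∫ z, integrand F G y z *
      (S.act y (H (x - y)) * S.cocycle y (x - y)) := by
    rw [mul_apply]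
    refine integral_congr_ae (Filter.Eventually.of_forall fun y => ?_)
    simp only [integrand]
    rw [mul_apply, mul_assoc]
    exact (((ContinuousLinearMap.mul ℂ 𝒜).flip (S.act y (H (x - y)) * S.cocycle y (x - y))
      ).integral_comp_comm (integrable_integrand F G y)).symm
  have hR : (F * (G * H)) x = ∫ z, ∫ y, integrand F G y z *
      (S.act y (H (x - y)) * S.cocycle y (x - y)) := by
    rw [mul_apply]
    refine integral_congr_ae (Filter.Eventually.of_forall fun z => ?_)
    simp only [integrand]
    have h1 : S.act z ((G * H) (x - z)) = ∫ y, S.act z (integrand G H (x - z) (y - z)) := by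
      rw [mul_apply, ← integral_sub_right_eq_self (fun w => integrand G H (x - z) w) z]
      exact ((S.actL z).integral_comp_comm
        ((integrable_integrand G H (x - z)).comp_sub_right z)).symm
    have h2 : ∀ a b c : 𝒜, a * b * c = (ContinuousLinearMap.mul ℂ 𝒜 (a * c)) b := by
      intro a b c; simp only [ContinuousLinearMap.mul_apply']; ring
    rw [h1, h2, ← ContinuousLinearMap.integral_comp_comm]
    · refine integral_congr_ae (Filter.Eventually.of_forall fun y => ?_)
      simp only [ContinuousLinearMap.mul_apply', integrand, map_mul]
      have hc := S.cocycle_mul z (y - z) (x - y)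
      have ha := S.act_add z (y - z) (H (x - y))
      rw [show z + (y - z) = y by abel] at hc ha
      rw [show y - z + (x - y) = x - z by abel] at hc
      rw [show x - z - (y - z) = x - y by abel, ← ha]
      calc _ = F z * S.act z (G (y - z)) * S.act y (H (x - y)) *
          (S.act z (S.cocycle (y - z) (x - y)) * S.cocycle z (x - z)) := by ring
        _ = _ := by rw [← hc]; ring
    · exact (S.actL z).integrable_comp ((integrable_integrand G H (x - z)).comp_sub_right z)
  rw [hL, hR]
  refine integral_integral_swap_of_hasCompactSupport ?_ ?_
  · exact (continuous_integrand F G continuous_fst continuous_snd).mul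
      ((S.continuous_act_comp continuous_fst
        (H.continuous.comp (continuous_const.sub continuous_fst))).mul
      (S.continuous_cocycle_comp continuous_fst (continuous_const.sub continuous_fst)))
  · refine HasCompactSupport.intro ((F.hasCompactSupport.isCompact.add
      G.hasCompactSupport.isCompact).prod F.hasCompactSupport.isCompact) ?_
    rintro ⟨y, z⟩ hyz
    by_cases hz : z ∈ tsupport F
    · have : y - z ∉ tsupport G := fun h => hyz ⟨⟨z, hz, y - z, h, by simp⟩, hz⟩
      simp [integrand, image_eq_zero_of_notMem_tsupport this]
    · simp [integrand, image_eq_zero_of_notMem_tsupport hz]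

theorem star_mul' (F G : S.ConvAlg) : star (F * G) = star G * star F := by
  ext x
  rw [star_apply, mul_apply, mul_apply]
  have h1 : star (S.act x (∫ y, integrand F G (-x) y)) =
      ∫ y, star (S.act x (integrand F G (-x) y)) := by
    rw [← actL_apply, ← ContinuousLinearMap.integral_comp_comm _ (integrable_integrand F G (-x))]
    exact ((starL' ℝ : 𝒜 ≃L[ℝ] 𝒜).integral_comp_comm _).symm
  rw [h1, ← integral_sub_right_eq_self (fun y => star (S.act x (integrand F G (-x) y))) x]
  refine integral_congr_ae (Filter.Eventually.of_forall fun w => ?_)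
  simp only [integrand, star_apply, map_mul, star_mul]
  have e1 := S.cocycle_mul x (w - x) (-w)
  have e2 := S.cocycle_mul x (w - x) (x - w)
  rw [show x + (w - x) = w by abel] at e1 e2
  rw [show w - x + -w = -x by abel, S.cocycle_neg, mul_one, S.cocycle_neg, mul_one] at e1
  rw [show w - x + (x - w) = 0 by abel, show x - w = -(w - x) by abel, S.cocycle_neg,
    S.cocycle_zero_right, map_one, mul_one] at e2
  rw [show -x - (w - x) = -w by abel, ← e1, ← S.act_add, show x + (w - x) = w by abel]
  rw [show -(x - w) = w - x by abel, map_star, ← S.act_add, show w + (x - w) = x by abel]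
  have e3 : star (S.cocycle x (w - x)) = S.cocycle w (x - w) := by
    have hu := (Unitary.mem_iff.mp (S.cocycle_unitary x (w - x))).1
    rw [show x - w = -(w - x) by abel]
    calc _ = star (S.cocycle x (w - x)) * (S.cocycle x (w - x) * S.cocycle w (-(w - x))) := by
          rw [e2, mul_one]
      _ = _ := by rw [← mul_assoc, hu, one_mul]
  rw [e3]
  ring

theorem add_mul' (F G H : S.ConvAlg) : (F + G) * H = F * H + G * H := by
  ext x
  rw [add_apply, mul_apply, mul_apply, mul_apply,
    ← integral_add (integrable_integrand F H x) (integrable_integrand G H x)]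
  simp [integrand, add_mul]

theorem mul_add' (F G H : S.ConvAlg) : F * (G + H) = F * G + F * H := by
  ext x
  rw [add_apply, mul_apply, mul_apply, mul_apply,
    ← integral_add (integrable_integrand F G x) (integrable_integrand F H x)]
  simp [integrand, add_mul, mul_add]

theorem smul_mul' (c : ℂ) (F G : S.ConvAlg) : (c • F) * G = c • (F * G) := by
  ext x
  rw [smul_apply, mul_apply, mul_apply, ← integral_smul]
  simp [integrand]

theorem mul_smul' (c : ℂ) (F G : S.ConvAlg) : F * (c • G) = c • (F * G) := by
  ext x
  rw [smul_apply, mul_apply, mul_apply, ← integral_smul]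
  simp [integrand]

instance : NonUnitalRing S.ConvAlg where
  left_distrib := mul_add'
  right_distrib := add_mul'
  zero_mul F := by ext x; simp [mul_apply, integrand]
  mul_zero F := by ext x; simp [mul_apply, integrand]
  mul_assoc := mul_assoc'

instance : StarRing S.ConvAlg where
  star_involutive F := by
    ext x
    simp [star_apply, ← S.act_add, map_star, S.act_zero]
  star_mul := star_mul'
  star_add F G := by ext x; simp [star_apply]

instance : IsScalarTower ℂ S.ConvAlg S.ConvAlg := ⟨fun c F G => smul_mul' c F G⟩
instance : SMulCommClass ℂ S.ConvAlg S.ConvAlg := ⟨fun c F G => (mul_smul' c F G).symm⟩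
instance : StarModule ℂ S.ConvAlg := ⟨fun c F => by ext x; simp [star_apply]⟩

/-- A `C*`-seminorm on the convolution algebra which is dominated by the `L¹`-norm. -/
structure IsCStarSeminorm (p : Seminorm ℂ S.ConvAlg) : Prop where
  mul_le : ∀ F G, p (F * G) ≤ p F * p G
  star_mul_self : ∀ F, p (star F * F) = p F * p F
  le_L1 : ∀ F, p F ≤ ∫ x, ‖F x‖

theorem IsCStarSeminorm.star_eq {p : Seminorm ℂ S.ConvAlg} (hp : IsCStarSeminorm p)
    (F : S.ConvAlg) : p (star F) = p F := by
  have key : ∀ G : S.ConvAlg, p G ≤ p (star G) := by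
    intro G
    rcases (apply_nonneg p G).eq_or_lt with h | h
    · rw [← h]; exact apply_nonneg _ _
    · have := (hp.star_mul_self G).symm.trans_le (hp.mul_le (star G) G)
      exact le_of_mul_le_mul_right this h
  exact le_antisymm (by simpa using key (star F)) (key F)

theorem isCStarSeminorm_zero : IsCStarSeminorm (0 : Seminorm ℂ S.ConvAlg) :=
  ⟨by simp, by simp, fun F => integral_nonneg fun x => norm_nonneg _⟩

theorem bddAbove_isCStarSeminorm : BddAbove {p : Seminorm ℂ S.ConvAlg | IsCStarSeminorm p} := by
  rw [Seminorm.bddAbove_iff]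
  refine ⟨fun F => ∫ x, ‖F x‖, ?_⟩
  rintro _ ⟨p, hp, rfl⟩ F
  exact hp.le_L1 F

variable (S) in
/-- The universal (maximal) `C*`-norm: the supremum of all `C*`-seminorms dominated by the
`L¹`-norm, equivalently the supremum of `‖π F‖` over all `L¹`-contractive `*`-representations. -/
def universalNorm : Seminorm ℂ S.ConvAlg := sSup {p | IsCStarSeminorm p}

theorem universalNorm_apply (F : S.ConvAlg) :
    universalNorm S F = ⨆ p : {p : Seminorm ℂ S.ConvAlg | IsCStarSeminorm p}, p.1 F :=
  Seminorm.sSup_apply bddAbove_isCStarSeminorm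

theorem le_universalNorm {p : Seminorm ℂ S.ConvAlg} (hp : IsCStarSeminorm p) :
    p ≤ universalNorm S :=
  le_csSup bddAbove_isCStarSeminorm hp

theorem universalNorm_le (F : S.ConvAlg) {C : ℝ}
    (h : ∀ p : Seminorm ℂ S.ConvAlg, IsCStarSeminorm p → p F ≤ C) : universalNorm S F ≤ C := by
  rw [universalNorm_apply]
  have : Nonempty {p : Seminorm ℂ S.ConvAlg | IsCStarSeminorm p} := ⟨⟨0, isCStarSeminorm_zero⟩⟩
  exact ciSup_le fun p => h p.1 p.2

theorem isCStarSeminorm_universalNorm : IsCStarSeminorm (universalNorm S) where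
  mul_le F G := universalNorm_le _ fun p hp => (hp.mul_le F G).trans
    (mul_le_mul (le_universalNorm hp F) (le_universalNorm hp G) (apply_nonneg _ _)
      (apply_nonneg _ _))
  star_mul_self F := by
    refine le_antisymm (universalNorm_le _ fun p hp => ?_) ?_
    · rw [hp.star_mul_self]
      exact mul_self_le_mul_self (apply_nonneg _ _) (le_universalNorm hp F)
    · have h : universalNorm S F ≤ √(universalNorm S (star F * F)) := by
        refine universalNorm_le _ fun p hp => Real.le_sqrt_of_sq_le ?_
        rw [sq, ← hp.star_mul_self]
        exact le_universalNorm hp _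
      calc _ ≤ √(universalNorm S (star F * F)) * √(universalNorm S (star F * F)) :=
            mul_self_le_mul_self (apply_nonneg _ _) h
        _ = _ := Real.mul_self_sqrt (apply_nonneg _ _)
  le_L1 F := universalNorm_le _ fun p hp => hp.le_L1 F

instance : SeminormedAddCommGroup S.ConvAlg :=
  (universalNorm S).toAddGroupSeminorm.toSeminormedAddCommGroup

theorem norm_def (F : S.ConvAlg) : ‖F‖ = universalNorm S F := rfl

instance : NormedSpace ℂ S.ConvAlg where
  norm_smul_le c F := (map_smul_eq_mul (universalNorm S) c F).le

instance : NonUnitalSeminormedRing S.ConvAlg where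
  dist_eq _ _ := rfl
  norm_mul_le := isCStarSeminorm_universalNorm.mul_le

theorem norm_star' (F : S.ConvAlg) : ‖star F‖ = ‖F‖ := isCStarSeminorm_universalNorm.star_eq F

theorem norm_star_mul_self' (F : S.ConvAlg) : ‖star F * F‖ = ‖F‖ * ‖F‖ :=
  isCStarSeminorm_universalNorm.star_mul_self F

theorem uniformContinuous_star : UniformContinuous (star : S.ConvAlg → S.ConvAlg) :=
  (AddMonoidHomClass.isometry_of_norm (starAddEquiv : S.ConvAlg ≃+ S.ConvAlg)
    norm_star').uniformContinuous

end ConvAlg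

/-- The twisted crossed product `𝒜 ⋊_{α,σ} ℝ^d`: the completion of the convolution algebra
in the universal `C*`-norm. -/
def CrossedProduct (S : TwistedSystem d 𝒜) : Type _ := UniformSpace.Completion S.ConvAlg

namespace CrossedProduct
open UniformSpace UniformSpace.Completion

instance : NormedAddCommGroup S.CrossedProduct :=
  inferInstanceAs (NormedAddCommGroup (Completion S.ConvAlg))
instance : NormedSpace ℂ S.CrossedProduct :=
  inferInstanceAs (NormedSpace ℂ (Completion S.ConvAlg))
instance : CompleteSpace S.CrossedProduct :=
  inferInstanceAs (CompleteSpace (Completion S.ConvAlg))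

/-- The canonical map `C_c(ℝ^d, 𝒜) → 𝒜 ⋊_{α,σ} ℝ^d`. -/
def of : S.ConvAlg →ₗᵢ[ℂ] S.CrossedProduct := toComplₗᵢ (𝕜 := ℂ) (E := S.ConvAlg)

variable {S}

theorem isDenseInducing_of : IsDenseInducing (of S) :=
  isDenseInducing_coe (α := S.ConvAlg)

theorem ind₁ {P : S.CrossedProduct → Prop} (a : S.CrossedProduct)
    (hc : IsClosed {a | P a}) (h : ∀ F, P (of S F)) : P a :=
  isDenseInducing_of.dense.induction_on a hc h

theorem ind₂ {P : S.CrossedProduct → S.CrossedProduct → Prop} (a b : S.CrossedProduct)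
    (hc : IsClosed {p : S.CrossedProduct × S.CrossedProduct | P p.1 p.2})
    (h : ∀ F G, P (of S F) (of S G)) : P a b :=
  Completion.induction_on₂ (α := S.ConvAlg) (β := S.ConvAlg) a b hc h

theorem ind₃ {P : S.CrossedProduct → S.CrossedProduct → S.CrossedProduct → Prop}
    (a b c : S.CrossedProduct)
    (hc : IsClosed {p : S.CrossedProduct × S.CrossedProduct × S.CrossedProduct |
      P p.1 p.2.1 p.2.2})
    (h : ∀ F G H, P (of S F) (of S G) (of S H)) : P a b c :=
  Completion.induction_on₃ (α := S.ConvAlg) (β := S.ConvAlg) (γ := S.ConvAlg) a b c hc h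

/-- The unique continuous extension of the convolution product. -/
instance : Mul S.CrossedProduct :=
  ⟨fun a b => (isDenseInducing_of.prodMap isDenseInducing_of).extend
    (fun p : S.ConvAlg × S.ConvAlg => of S (p.1 * p.2)) (a, b)⟩

/-- The unique continuous extension of the involution. -/
instance : Star S.CrossedProduct :=
  ⟨Completion.map (star : S.ConvAlg → S.ConvAlg)⟩

theorem of_mul (F G : S.ConvAlg) : of S (F * G) = of S F * of S G :=
  ((isDenseInducing_of.prodMap isDenseInducing_of).extend_eq
    ((of S).continuous.comp continuous_mul) (F, G)).symm

theorem of_star (F : S.ConvAlg) : of S (star F) = star (of S F) :=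
  (Completion.map_coe ConvAlg.uniformContinuous_star F).symm

theorem continuous_mul' : Continuous fun p : S.CrossedProduct × S.CrossedProduct => p.1 * p.2 := by
  let m : S.ConvAlg →+ S.ConvAlg →+ S.CrossedProduct :=
    (AddMonoidHom.mul : S.ConvAlg →+ S.ConvAlg →+ S.ConvAlg).compr₂
      (of S).toLinearMap.toAddMonoidHom
  have hm : Continuous fun p : S.ConvAlg × S.ConvAlg => m p.1 p.2 :=
    (of S).continuous.comp continuous_mul
  have di : IsDenseInducing ((of S).toLinearMap.toAddMonoidHom : S.ConvAlg → S.CrossedProduct) :=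
    isDenseInducing_of
  exact di.extend_Z_bilin di hm

theorem continuous_star' : Continuous (star : S.CrossedProduct → S.CrossedProduct) :=
  Completion.continuous_map

instance : ContinuousMul S.CrossedProduct := ⟨continuous_mul'⟩
instance : ContinuousStar S.CrossedProduct := ⟨continuous_star'⟩

instance : NonUnitalNormedRing S.CrossedProduct where
  left_distrib a b c := by
    induction a, b, c using ind₃ with
    | hc => exact isClosed_eq (by fun_prop) (by fun_prop)
    | h F G H =>
      rw [← map_add, ← of_mul, ← of_mul, ← of_mul, ← map_add, mul_add]
  right_distrib a b c := by
    induction a, b, c using ind₃ with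
    | hc => exact isClosed_eq (by fun_prop) (by fun_prop)
    | h F G H =>
      rw [← map_add, ← of_mul, ← of_mul, ← of_mul, ← map_add, add_mul]
  zero_mul a := by
    induction a using ind₁ with
    | hc => exact isClosed_eq (by fun_prop) (by fun_prop)
    | h F =>
      rw [← map_zero (of S), ← of_mul, zero_mul]
  mul_zero a := by
    induction a using ind₁ with
    | hc => exact isClosed_eq (by fun_prop) (by fun_prop)
    | h F =>
      rw [← map_zero (of S), ← of_mul, mul_zero]
  mul_assoc a b c := by
    induction a, b, c using ind₃ with
    | hc => exact isClosed_eq (by fun_prop) (by fun_prop)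
    | h F G H =>
      rw [← of_mul, ← of_mul, ← of_mul, ← of_mul, mul_assoc]
  dist_eq := dist_eq_norm_neg_add
  norm_mul_le a b := by
    induction a, b using ind₂ with
    | hc => exact isClosed_le (by fun_prop) (by fun_prop)
    | h F G =>
      rw [← of_mul, (of S).norm_map, (of S).norm_map, (of S).norm_map]
      exact norm_mul_le F G

instance : StarRing S.CrossedProduct where
  star_involutive a := by
    induction a using ind₁ with
    | hc => exact isClosed_eq (by fun_prop) (by fun_prop)
    | h F =>
      rw [← of_star, ← of_star, star_star]
  star_mul a b := by
    induction a, b using ind₂ with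
    | hc => exact isClosed_eq (by fun_prop) (by fun_prop)
    | h F G =>
      rw [← of_mul, ← of_star, ← of_star, ← of_star, ← of_mul, star_mul]
  star_add a b := by
    induction a, b using ind₂ with
    | hc => exact isClosed_eq (by fun_prop) (by fun_prop)
    | h F G =>
      rw [← map_add, ← of_star, ← of_star, ← of_star, ← map_add, star_add]

theorem smul_mul' (c : ℂ) (a b : S.CrossedProduct) : (c • a) * b = c • (a * b) := by
  induction a, b using ind₂ with
  | hc =>
    exact isClosed_eq ((continuous_fst.const_smul c).mul continuous_snd)
      ((continuous_fst.mul continuous_snd).const_smul c)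
  | h F G => rw [← map_smul, ← of_mul, ← of_mul, ← map_smul, smul_mul_assoc]

theorem mul_smul' (c : ℂ) (a b : S.CrossedProduct) : a * (c • b) = c • (a * b) := by
  induction a, b using ind₂ with
  | hc =>
    exact isClosed_eq (continuous_fst.mul (continuous_snd.const_smul c))
      ((continuous_fst.mul continuous_snd).const_smul c)
  | h F G => rw [← map_smul, ← of_mul, ← of_mul, ← map_smul, mul_smul_comm]

theorem star_smul' (c : ℂ) (a : S.CrossedProduct) : star (c • a) = star c • star a := by
  induction a using ind₁ with
  | hc =>
    exact isClosed_eq (continuous_id.const_smul c).star (continuous_star.const_smul (star c))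
  | h F => rw [← map_smul, ← of_star, ← of_star, ← map_smul, star_smul]

instance : CStarRing S.CrossedProduct where
  norm_mul_self_le a := by
    induction a using ind₁ with
    | hc => exact isClosed_le (by fun_prop) (by fun_prop)
    | h F =>
      rw [← of_star, ← of_mul, (of S).norm_map, (of S).norm_map]
      exact (ConvAlg.norm_star_mul_self' F).ge

instance : IsScalarTower ℂ S.CrossedProduct S.CrossedProduct := ⟨smul_mul'⟩
instance : SMulCommClass ℂ S.CrossedProduct S.CrossedProduct :=
  ⟨fun c a b => (mul_smul' c a b).symm⟩
instance : StarModule ℂ S.CrossedProduct := ⟨star_smul'⟩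

instance : NonUnitalCStarAlgebra S.CrossedProduct where

end CrossedProduct
end TwistedSystem

/-! ### The hull, its algebra of functions on the orbit, and the magnetic cocycle -/

section Hull

variable (d : ℕ) {Ω : Type*} [TopologicalSpace Ω] [CompactSpace Ω]
  [TopologicalSpace.MetrizableSpace Ω] [AddAction (Euc d) Ω] [ContinuousVAdd (Euc d) Ω]

/-- The orbit map `q ↦ α_q⁻¹(ω₀)`, where `α_x(ω) = x +ᵥ ω`. -/
def orbitMap (ω₀ : Ω) : C(Euc d, Ω) := ⟨fun q => -q +ᵥ ω₀, by fun_prop⟩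

/-- Restriction of `f ∈ C(Ω)` to the orbit of `ω₀`: the function `q ↦ f(α_q⁻¹(ω₀))` on `ℝ^d`. -/
def orbitHom (ω₀ : Ω) : C(Ω, ℂ) →⋆ₐ[ℂ] (Euc d →ᵇ ℂ) where
  toFun f := (BoundedContinuousFunction.mkOfCompact f).compContinuous (orbitMap d ω₀)
  map_one' := rfl
  map_mul' _ _ := rfl
  map_zero' := rfl
  map_add' _ _ := rfl
  commutes' _ := rfl
  map_star' _ := rfl

@[simp] theorem orbitHom_apply (ω₀ : Ω) (f : C(Ω, ℂ)) (q : Euc d) :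
    orbitHom d ω₀ f q = f (-q +ᵥ ω₀) := rfl

theorem continuous_orbitHom (ω₀ : Ω) : Continuous (orbitHom d ω₀) :=
  AddMonoidHomClass.continuous_of_bound (orbitHom d ω₀) 1 fun f => by
    simpa using NonUnitalStarAlgHom.norm_apply_le (orbitHom d ω₀) f

/-- The algebra `𝒞` of all functions on `ℝ^d` of the form `q ↦ f(α_q⁻¹(ω₀))` with `f ∈ C(Ω)`,
as a `*`-subalgebra of the bounded continuous functions with the supremum norm. -/
def orbitAlgebra (ω₀ : Ω) : StarSubalgebra ℂ (Euc d →ᵇ ℂ) := (orbitHom d ω₀).range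

theorem mem_orbitAlgebra {ω₀ : Ω} {g : Euc d →ᵇ ℂ} :
    g ∈ orbitAlgebra d ω₀ ↔ ∃ f : C(Ω, ℂ), orbitHom d ω₀ f = g := Iff.rfl

instance isClosed_orbitAlgebra (ω₀ : Ω) :
    IsClosed (orbitAlgebra d ω₀ : Set (Euc d →ᵇ ℂ)) := by
  let K : Set Ω := closure (Set.range (orbitMap d ω₀))
  have hK : IsCompact K := isClosed_closure.isCompact
  have : CompactSpace K := isCompact_iff_compactSpace.mp hK
  let r : C(K, ℂ) → (Euc d →ᵇ ℂ) := fun f =>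
    (BoundedContinuousFunction.mkOfCompact f).compContinuous
      ⟨fun q => ⟨orbitMap d ω₀ q, subset_closure ⟨q, rfl⟩⟩, by fun_prop⟩
  have hr : Isometry r := by
    refine Isometry.of_dist_eq fun f g => le_antisymm ?_ ?_
    · refine (BoundedContinuousFunction.dist_le dist_nonneg).2 fun q => ?_
      exact ContinuousMap.dist_apply_le_dist (f := f) (g := g) _
    · refine (ContinuousMap.dist_le dist_nonneg).2 ?_
      have hd : Dense {k : K | (k : Ω) ∈ Set.range (orbitMap d ω₀)} := by
        have h := Topology.IsInducing.subtypeVal (t := K)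
        intro k
        rw [h.closure_eq_preimage_closure_image]
        have : (Subtype.val '' {k : K | (k : Ω) ∈ Set.range (orbitMap d ω₀)})
            = Set.range (orbitMap d ω₀) := by
          ext ω
          constructor
          · rintro ⟨k, hk, rfl⟩; exact hk
          · intro hω; exact ⟨⟨ω, subset_closure hω⟩, hω, rfl⟩
        rw [Set.mem_preimage, this]
        exact k.2
      intro k
      have hcl : IsClosed {k : K | dist (f k) (g k) ≤ dist (r f) (r g)} :=
        isClosed_le (by fun_prop) continuous_const
      refine hcl.closure_subset_iff.2 ?_ (hd k)
      rintro ⟨_, hk⟩ ⟨q, rfl⟩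
      exact BoundedContinuousFunction.dist_coe_le_dist (f := r f) (g := r g) q
  have hrange : (orbitAlgebra d ω₀ : Set (Euc d →ᵇ ℂ)) = Set.range r := by
    ext g
    constructor
    · rintro ⟨f, rfl⟩
      exact ⟨f.restrict K, rfl⟩
    · rintro ⟨f, rfl⟩
      obtain ⟨g, hg⟩ := ContinuousMap.exists_restrict_eq isClosed_closure f
      exact ⟨g, by rw [← hg]; rfl⟩
  rw [hrange]
  exact hr.isClosedEmbedding.isClosed_range

/-- Translation of functions on `ℝ^d`: `f ↦ f(· + x)`. -/
def translation (x : Euc d) : (Euc d →ᵇ ℂ) →⋆ₐ[ℂ] (Euc d →ᵇ ℂ) where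
  toFun f := f.compContinuous ⟨fun q => q + x, by fun_prop⟩
  map_one' := rfl
  map_mul' _ _ := rfl
  map_zero' := rfl
  map_add' _ _ := rfl
  commutes' _ := rfl
  map_star' _ := rfl

@[simp] theorem translation_apply (x : Euc d) (f : Euc d →ᵇ ℂ) (q : Euc d) :
    translation d x f q = f (q + x) := rfl

/-- The action on `C(Ω)` by pull back: `(α_x f)(ω) = f(α_x⁻¹(ω))`. -/
def hullShift (x : Euc d) (f : C(Ω, ℂ)) : C(Ω, ℂ) := f.comp ⟨fun ω => -x +ᵥ ω, by fun_prop⟩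

theorem translation_orbitHom (ω₀ : Ω) (x : Euc d) (f : C(Ω, ℂ)) :
    translation d x (orbitHom d ω₀ f) = orbitHom d ω₀ (hullShift d x f) := by
  ext q
  simp only [translation_apply, orbitHom_apply, hullShift, ContinuousMap.comp_apply,
    ContinuousMap.coe_mk, ← add_vadd]
  congr 2
  abel

theorem continuous_hullShift (f : C(Ω, ℂ)) : Continuous fun x : Euc d => hullShift d x f := by
  refine ContinuousMap.continuous_of_continuous_uncurry _ ?_
  simp only [Function.uncurry_def, hullShift, ContinuousMap.comp_apply, ContinuousMap.coe_mk]
  fun_prop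

/-- The translation action `(α_x f)(q) = f(q + x)` on `𝒞`. -/
def orbitAction (ω₀ : Ω) (x : Euc d) : orbitAlgebra d ω₀ →⋆ₐ[ℂ] orbitAlgebra d ω₀ :=
  ((translation d x).comp (orbitAlgebra d ω₀).subtype).codRestrict (orbitAlgebra d ω₀) (by
    rintro ⟨_, f, rfl⟩
    exact ⟨hullShift d x f, (translation_orbitHom d ω₀ x f).symm⟩)

theorem coe_orbitAction (ω₀ : Ω) (x : Euc d) (f : orbitAlgebra d ω₀) :
    (orbitAction d ω₀ x f : Euc d →ᵇ ℂ) = translation d x f := rfl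

end Hull

section Magnetic
variable {d : ℕ}

/-- The flux of the `2`-form `β` through the oriented triangle with corners `a, b, c`, i.e. the
integral of `β` over `(s, t) ↦ a + s (b - a) + t (c - b)`, `0 ≤ t ≤ s ≤ 1`. -/
def triangleFlux (β : Euc d → Euc d [⋀^Fin 2]→L[ℝ] ℝ) (a b c : Euc d) : ℝ :=
  ∫ s in (0 : ℝ)..1, ∫ t in (0 : ℝ)..s, β (a + s • (b - a) + t • (c - b)) ![b - a, c - b]

/-- A configuration dependent magnetic field: a continuous map `b` from `Ω` to the `2`-forms on `ℝ^d`,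
giving for every configuration `ω` the field `B_ω(p) = b(α_p⁻¹(ω))`. Each `B_ω` is closed; as `B_ω`
is merely continuous this is expressed by the vanishing of its net flux through the boundary of
every tetrahedron. -/
structure MagneticField (d : ℕ) (Ω : Type*) [TopologicalSpace Ω] [AddAction (Euc d) Ω] where
  toFun : Ω → Euc d [⋀^Fin 2]→L[ℝ] ℝ
  continuous_toFun : Continuous toFun
  closed : ∀ (ω : Ω) (a b c e : Euc d),
    triangleFlux (fun p => toFun (-p +ᵥ ω)) b c e - triangleFlux (fun p => toFun (-p +ᵥ ω)) a c e
      + triangleFlux (fun p => toFun (-p +ᵥ ω)) a b e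
      - triangleFlux (fun p => toFun (-p +ᵥ ω)) a b c = 0

variable {Ω : Type*} [TopologicalSpace Ω] [CompactSpace Ω]
  [TopologicalSpace.MetrizableSpace Ω] [AddAction (Euc d) Ω] [ContinuousVAdd (Euc d) Ω]

namespace MagneticField

/-- The magnetic field `B_ω` on `ℝ^d` of the configuration `ω`. -/
def fieldAt (B : MagneticField d Ω) (ω : Ω) (p : Euc d) : Euc d [⋀^Fin 2]→L[ℝ] ℝ :=
  B.toFun (-p +ᵥ ω)

/-- The flux `Φ_ω(a, b, c)` of `B_ω` through the triangle with corners `a, b, c`. -/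
def flux (B : MagneticField d Ω) (ω : Ω) (a b c : Euc d) : ℝ := triangleFlux (B.fieldAt ω) a b c

theorem flux_vadd (B : MagneticField d Ω) (q : Euc d) (ω : Ω) (a b c : Euc d) :
    B.flux (-q +ᵥ ω) a b c = B.flux ω (a + q) (b + q) (c + q) := by
  simp only [flux, triangleFlux, fieldAt, ← add_vadd, add_sub_add_right_eq_sub]
  congr! 7
  abel

theorem flux_closed (B : MagneticField d Ω) (ω : Ω) (a b c e : Euc d) :
    B.flux ω b c e - B.flux ω a c e + B.flux ω a b e - B.flux ω a b c = 0 :=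
  B.closed ω a b c e

theorem flux_eq_zero_of_left (B : MagneticField d Ω) (ω : Ω) {a b c : Euc d}
    (h : b - a = 0) : B.flux ω a b c = 0 := by
  have (p : Euc d) : B.fieldAt ω p ![0, c - b] = 0 :=
    (B.fieldAt ω p).map_coord_zero (i := 0) rfl
  simp [flux, triangleFlux, h, this]

theorem flux_eq_zero_of_right (B : MagneticField d Ω) (ω : Ω) {a b c : Euc d}
    (h : c - b = 0) : B.flux ω a b c = 0 := by
  have (p : Euc d) : B.fieldAt ω p ![b - a, 0] = 0 :=
    (B.fieldAt ω p).map_coord_zero (i := 1) rfl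
  simp [flux, triangleFlux, h, this]

theorem flux_eq_zero_of_neg (B : MagneticField d Ω) (ω : Ω) {a b c : Euc d}
    (h : c - b = -(b - a)) : B.flux ω a b c = 0 := by
  have (p : Euc d) : B.fieldAt ω p ![b - a, -(b - a)] = 0 := by
    have h2 : ![b - a, -(b - a)] = Function.update ![b - a, b - a] 1 ((-1 : ℝ) • (b - a)) := by
      ext i; fin_cases i <;> simp
    rw [h2, (B.fieldAt ω p).map_update_smul]
    have h3 : Function.update ![b - a, b - a] 1 (b - a) = ![b - a, b - a] := by
      ext i; fin_cases i <;> simp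
    rw [h3, (B.fieldAt ω p).map_eq_zero_of_eq ![b - a, b - a] (i := 0) (j := 1) rfl (by simp),
      smul_zero]
  simp only [flux, triangleFlux, h, this]
  simp

theorem continuous_flux (B : MagneticField d Ω) {X : Type*} [TopologicalSpace X]
    [FirstCountableTopology X] {w : X → Ω} {a b c : X → Euc d} (hw : Continuous w)
    (ha : Continuous a) (hb : Continuous b) (hc : Continuous c) :
    Continuous fun x => B.flux (w x) (a x) (b x) (c x) := by
  have hB := B.continuous_toFun
  refine intervalIntegral.continuous_parametric_intervalIntegral_of_continuous' ?_ 0 1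
  refine intervalIntegral.continuous_parametric_intervalIntegral_of_continuous
    (X := X × ℝ) ?_ continuous_snd
  have h1 : Continuous fun p : (X × ℝ) × ℝ => B.fieldAt (w p.1.1)
      (a p.1.1 + p.1.2 • (b p.1.1 - a p.1.1) + p.2 • (c p.1.1 - b p.1.1)) := by
    unfold fieldAt
    fun_prop
  have h2 : Continuous fun p : (X × ℝ) × ℝ => ![b p.1.1 - a p.1.1, c p.1.1 - b p.1.1] := by
    fun_prop
  exact h1.eval h2

/-- The cocycle `σ(x, y)(ω) = exp(-i Φ_ω(0, x, x + y))` with values in `C(Ω)`. -/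
def cocycle (B : MagneticField d Ω) (x y : Euc d) : C(Ω, ℂ) where
  toFun ω := Complex.exp (-Complex.I * B.flux ω 0 x (x + y))
  continuous_toFun := by
    have := B.continuous_flux (w := fun ω : Ω => ω) (a := fun _ => 0) (b := fun _ => x)
      (c := fun _ => x + y) continuous_id continuous_const continuous_const continuous_const
    fun_prop

theorem cocycle_apply (B : MagneticField d Ω) (x y : Euc d) (ω : Ω) :
    B.cocycle x y ω = Complex.exp (-Complex.I * B.flux ω 0 x (x + y)) := rfl

theorem continuous_cocycle (B : MagneticField d Ω) :
    Continuous fun p : Euc d × Euc d => B.cocycle p.1 p.2 := by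
  refine ContinuousMap.continuous_of_continuous_uncurry _ ?_
  have := B.continuous_flux (X := (Euc d × Euc d) × Ω) (w := fun p => p.2) (a := fun _ => 0)
    (b := fun p => p.1.1) (c := fun p => p.1.1 + p.1.2) (by fun_prop) (by fun_prop)
    (by fun_prop) (by fun_prop)
  simp only [Function.uncurry_def, cocycle_apply]
  fun_prop

/-- The cocycle `σ̃(x, y)(q) = σ(x, y)(α_q⁻¹(ω₀))` with values in `𝒞`. -/
def orbitCocycle (B : MagneticField d Ω) (ω₀ : Ω) (x y : Euc d) : orbitAlgebra d ω₀ :=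
  ⟨orbitHom d ω₀ (B.cocycle x y), B.cocycle x y, rfl⟩

theorem orbitCocycle_apply (B : MagneticField d Ω) (ω₀ : Ω) (x y q : Euc d) :
    (B.orbitCocycle ω₀ x y : Euc d →ᵇ ℂ) q =
      Complex.exp (-Complex.I * B.flux ω₀ q (q + x) (q + x + y)) := by
  change Complex.exp (-Complex.I * B.flux (-q +ᵥ ω₀) 0 x (x + y)) = _
  rw [flux_vadd, zero_add, add_comm x q, add_right_comm, add_comm x q]

/-- The twisted action `(α̃, σ̃)` of `ℝ^d` on `𝒞`. -/
def system (B : MagneticField d Ω) (ω₀ : Ω) : TwistedSystem d (orbitAlgebra d ω₀) where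
  act := orbitAction d ω₀
  act_zero f := by
    ext q; simp [coe_orbitAction]
  act_add x y f := by
    ext q; simp [coe_orbitAction, add_assoc]
  continuous_act := by
    rintro ⟨_, f, rfl⟩
    refine Continuous.subtype_mk ?_ _
    have : (fun x : Euc d => translation d x (orbitHom d ω₀ f)) =
        fun x => orbitHom d ω₀ (hullShift d x f) :=
      funext fun x => translation_orbitHom d ω₀ x f
    exact this ▸ (continuous_orbitHom d ω₀).comp (continuous_hullShift d f)
  cocycle := B.orbitCocycle ω₀
  continuous_cocycle :=
    ((continuous_orbitHom d ω₀).comp B.continuous_cocycle).subtype_mk _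
  cocycle_unitary x y := by
    have h : star (B.orbitCocycle ω₀ x y) * B.orbitCocycle ω₀ x y = 1 := by
      ext q
      change star ((B.orbitCocycle ω₀ x y : Euc d →ᵇ ℂ) q) *
        (B.orbitCocycle ω₀ x y : Euc d →ᵇ ℂ) q = 1
      rw [orbitCocycle_apply, Complex.star_def, ← Complex.exp_conj, ← Complex.exp_add]
      simp
    exact Unitary.mem_iff.mpr ⟨h, by rw [mul_comm]; exact h⟩
  cocycle_mul x y z := by
    ext q
    change (B.orbitCocycle ω₀ x y : Euc d →ᵇ ℂ) q * (B.orbitCocycle ω₀ (x + y) z : Euc d →ᵇ ℂ) q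
      = (B.orbitCocycle ω₀ y z : Euc d →ᵇ ℂ) (q + x) *
        (B.orbitCocycle ω₀ x (y + z) : Euc d →ᵇ ℂ) q
    simp only [orbitCocycle_apply, ← Complex.exp_add]
    have h := B.flux_closed ω₀ q (q + x) (q + x + y) (q + x + y + z)
    have h' : B.flux ω₀ q (q + x) (q + x + y) + B.flux ω₀ q (q + x + y) (q + x + y + z) =
      B.flux ω₀ (q + x) (q + x + y) (q + x + y + z) + B.flux ω₀ q (q + x) (q + x + y + z) := by
      linarith
    rw [← mul_add, ← mul_add, ← Complex.ofReal_add, ← Complex.ofReal_add, ← add_assoc q x y,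
      ← add_assoc (q + x) y z, h']
  cocycle_zero_left x := by
    ext q
    change (B.orbitCocycle ω₀ 0 x : Euc d →ᵇ ℂ) q = 1
    rw [orbitCocycle_apply, add_zero, flux_eq_zero_of_left B ω₀ (sub_self q)]
    simp
  cocycle_zero_right x := by
    ext q
    change (B.orbitCocycle ω₀ x 0 : Euc d →ᵇ ℂ) q = 1
    rw [orbitCocycle_apply, add_zero, flux_eq_zero_of_right B ω₀ (sub_self (q + x))]
    simp
  cocycle_neg x := by
    ext q
    change (B.orbitCocycle ω₀ x (-x) : Euc d →ᵇ ℂ) q = 1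
    rw [orbitCocycle_apply, flux_eq_zero_of_neg B ω₀ (by abel)]
    simp

end MagneticField

end Magnetic

/-! ### Real structures and vector potentials -/

/-- A real structure on a (trivially graded) `C*`-algebra: an anti-linear `*`-automorphism of order
two which preserves the norm. -/
structure IsRealStructure {𝒜 : Type*} [NonUnitalCStarAlgebra 𝒜] (R : 𝒜 → 𝒜) : Prop where
  map_add : ∀ a b, R (a + b) = R a + R b
  map_smul : ∀ (c : ℂ) a, R (c • a) = star c • R a
  map_mul : ∀ a b, R (a * b) = R a * R b
  map_star : ∀ a, R (star a) = star (R a)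
  involutive : Function.Involutive R
  norm_map : ∀ a, ‖R a‖ = ‖a‖

section VectorPotential

variable {d : ℕ}

/-- The `1`-form `A` is a vector potential of the `2`-form `β`: `β = dA` in the sense of
distributions, i.e. `β(u, v) = ∂_u (A v) - ∂_v (A u)` weakly for all vectors `u, v`. -/
def IsVectorPotential (A : Euc d → (Euc d →L[ℝ] ℝ)) (β : Euc d → Euc d [⋀^Fin 2]→L[ℝ] ℝ) : Prop :=
  ∀ φ : Euc d → ℝ, ContDiff ℝ ((⊤ : ℕ∞) : WithTop ℕ∞) φ → HasCompactSupport φ → ∀ u v : Euc d,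
    ∫ q, β q ![u, v] * φ q = ∫ q, (A q u * fderiv ℝ φ q v - A q v * fderiv ℝ φ q u)

/-- The phase `λ(x)(q) = exp(-i ∫_{[q, q + x]} A)`. -/
def gaugePhase (A : Euc d → (Euc d →L[ℝ] ℝ)) (x q : Euc d) : ℂ :=
  Complex.exp (-Complex.I * ((∫ᶜ p in Path.segment q (q + x), A p : ℝ) : ℂ))

variable {Ω : Type*} [TopologicalSpace Ω] [CompactSpace Ω]
  [TopologicalSpace.MetrizableSpace Ω] [AddAction (Euc d) Ω] [ContinuousVAdd (Euc d) Ω]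

/-- The function `g` on `ℝ^d` belongs to the algebra `𝒞`. -/
def MemOrbitAlgebra (ω₀ : Ω) (g : Euc d → ℂ) : Prop :=
  ∃ f ∈ orbitAlgebra d ω₀, ∀ q, f q = g q

/-- The formula `𝔣(F)(z)(q) = conj (F(z)(q)) λ(z)(q)⁻²` maps `C_c(ℝ^d, 𝒞)` to itself and this map is
(i.e. extends to) a real structure on the crossed product of `𝒞` with `ℝ^d` twisted by the
cocycle of the magnetic field `B`. -/
def DefinesRealStructure (B : MagneticField d Ω) (ω₀ : Ω) (A : Euc d → (Euc d →L[ℝ] ℝ)) : Prop :=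
  ∃ R : (B.system ω₀).CrossedProduct → (B.system ω₀).CrossedProduct, IsRealStructure R ∧
    ∀ F : (B.system ω₀).ConvAlg, ∃ G : (B.system ω₀).ConvAlg,
      (∀ z q : Euc d, (G z : Euc d →ᵇ ℂ) q =
        star ((F z : Euc d →ᵇ ℂ) q) * gaugePhase A z q ^ (-2 : ℤ)) ∧
      R (TwistedSystem.CrossedProduct.of _ F) = TwistedSystem.CrossedProduct.of _ G

end VectorPotential

end

/-! Everything rests on Stokes' theorem for triangles, `stokes_triangle`, which survives for a
merely continuous `A` because mollified forms satisfy it and one can let the scale tend to zero.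
Exponentiated, it is the identity λ(x) α_x(λ(y)) = σ̃(x,y) λ(x+y) of `gaugePhase_mul`, valid whether
or not λ takes values in 𝒞.

Suppose all λ(z) lie in 𝒞. Then m = λ⁻² satisfies m(x+y) σ̃(x,y)^* = m(x) α_x(m(y)) σ̃(x,y), which
is exactly what makes F ↦ F^* m multiplicative and compatible with the involution. This map
preserves the L¹-norm and pulls C*-seminorms back to C*-seminorms, so it is isometric for the
universal norm and extends to the completion. It preserves C_c only if z ↦ λ(z) is norm continuous.
This is automatic: 𝒞 is separable, so Baire's theorem makes λ nearly constant on some open set, and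
the cocycle identity carries this to a neighbourhood of 0 (`eventually_norm_gaugePhase_sub_one_le`).

Conversely, if 𝔣 preserves C_c, applying it to scalar bump functions shows that λ² is 𝒞-valued and
norm continuous. The square root is taken through the logarithm: for small z the phase stays near 1
along the whole segment, so no branch is crossed and the line integral itself lies in 𝒞
(`memOrbitAlgebra_segmentIntegral`). Doubling segments reaches every z, and exponentiating gives
λ(z).

For the components, averages of `A` over segments of 𝒞-valued line integrals converge uniformly to
`A` when `A` is uniformly continuous, and 𝒞 is closed. In the other direction, line integrals of
elements of 𝒞 come from continuous functions on Ω, and elements of 𝒞 are uniformly continuous. -/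

noncomputable section

/-! ### Stokes' theorem on triangles -/

section Stokes

open Set intervalIntegral

/-- Fubini's theorem on the triangle `0 ≤ t ≤ s ≤ 1`. -/
theorem intervalIntegral_triangle_swap {g : ℝ → ℝ → ℝ} (hg : Continuous (Function.uncurry g)) :
    ∫ s in (0 : ℝ)..1, ∫ t in (0 : ℝ)..s, g s t = ∫ t in (0 : ℝ)..1, ∫ s in t..1, g s t := by
  let D : Set (ℝ × ℝ) := {p | p.2 ≤ p.1}
  have hD : MeasurableSet D := measurableSet_le measurable_snd measurable_fst
  let k : ℝ → ℝ → ℝ := fun s t => D.indicator (Function.uncurry g) (s, t)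
  have h1 : ∫ s in (0 : ℝ)..1, ∫ t in (0 : ℝ)..s, g s t =
      ∫ s in Ioc (0 : ℝ) 1, ∫ t in Ioc (0 : ℝ) 1, k s t := by
    rw [integral_of_le zero_le_one]
    refine setIntegral_congr_fun measurableSet_Ioc fun s hs => ?_
    have hk : (fun t => k s t) = (Iic s).indicator (g s) := by
      ext t; simp only [k, D, indicator_apply, mem_ofPred_eq, mem_Iic, Function.uncurry]
    simp only [hk]
    rw [setIntegral_indicator measurableSet_Iic, integral_of_le hs.1.le, Ioc_inter_Iic,
      min_eq_right hs.2]
  have h2 : ∫ t in (0 : ℝ)..1, ∫ s in t..1, g s t =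
      ∫ t in Ioc (0 : ℝ) 1, ∫ s in Ioc (0 : ℝ) 1, k s t := by
    rw [integral_of_le zero_le_one]
    refine setIntegral_congr_fun measurableSet_Ioc fun t ht => ?_
    have hk : (fun s => k s t) = (Ici t).indicator (fun s => g s t) := by
      ext s; simp only [k, D, indicator_apply, mem_ofPred_eq, mem_Ici, Function.uncurry]
    simp only [hk]
    have hI : Ioc (0 : ℝ) 1 ∩ Ici t = Icc t 1 := by
      ext s; simp only [mem_inter_iff, mem_Ioc, mem_Ici, mem_Icc]
      exact ⟨fun h => ⟨h.2, h.1.2⟩, fun h => ⟨⟨ht.1.trans_le h.1, h.2⟩, h.1⟩⟩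
    rw [setIntegral_indicator measurableSet_Ici, integral_of_le ht.2, hI,
      integral_Icc_eq_integral_Ioc]
  rw [h1, h2]
  refine integral_integral_swap ?_
  rw [Measure.prod_restrict]
  have : IntegrableOn (Function.uncurry g) (Ioc (0 : ℝ) 1 ×ˢ Ioc (0 : ℝ) 1) :=
    (hg.continuousOn.integrableOn_compact (isCompact_Icc.prod isCompact_Icc)).mono_set
      (prod_mono Ioc_subset_Icc_self Ioc_subset_Icc_self)
  exact this.indicator hD

variable {E : Type*} [NormedAddCommGroup E] [NormedSpace ℝ E]

/-- Stokes' theorem for a `C¹` one-form on the triangle with corners `a`, `a + u`, `a + u + v`. -/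
theorem stokes_triangle_of_hasFDerivAt {K : E → E →L[ℝ] ℝ} {K' : E → E →L[ℝ] E →L[ℝ] ℝ}
    (hK : ∀ x, HasFDerivAt K (K' x) x) (hK' : Continuous K') (a u v : E) :
    ∫ s in (0 : ℝ)..1, ∫ t in (0 : ℝ)..s,
        (K' (a + s • u + t • v) u v - K' (a + s • u + t • v) v u) =
      (∫ s in (0 : ℝ)..1, K (a + s • u) u) + (∫ t in (0 : ℝ)..1, K (a + u + t • v) v) -
        ∫ s in (0 : ℝ)..1, K (a + s • (u + v)) (u + v) := by
  have hKc : Continuous K := continuous_iff_continuousAt.2 fun x => (hK x).continuousAt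
  have hs (s t : ℝ) : HasDerivAt (fun s : ℝ => K (a + s • u + t • v) v)
      (K' (a + s • u + t • v) u v) s := by
    have h1 : HasDerivAt (fun s : ℝ => a + s • u + t • v) u s := by
      simpa using (((hasDerivAt_id s).smul_const u).const_add a).add_const (t • v)
    exact ((hK _).comp_hasDerivAt s h1).clm_apply (hasDerivAt_const s v) |>.congr_deriv (by simp)
  have ht (s t : ℝ) : HasDerivAt (fun t : ℝ => K (a + s • u + t • v) u)
      (K' (a + s • u + t • v) v u) t := by
    have h1 : HasDerivAt (fun t : ℝ => a + s • u + t • v) v t := by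
      simpa using ((hasDerivAt_id t).smul_const v).const_add (a + s • u)
    exact ((hK _).comp_hasDerivAt t h1).clm_apply (hasDerivAt_const t u) |>.congr_deriv (by simp)
  have hc1 : Continuous fun p : ℝ × ℝ => K' (a + p.1 • u + p.2 • v) u v := by fun_prop
  have hc2 : Continuous fun p : ℝ × ℝ => K' (a + p.1 • u + p.2 • v) v u := by fun_prop
  -- The integrand is an `s`-derivative, so the order of integration is swapped first. The limits `s
  -- = 1` and `s = t` give the second side and the `v`-part of the hypotenuse.
  have e1 : ∫ s in (0 : ℝ)..1, ∫ t in (0 : ℝ)..s, K' (a + s • u + t • v) u v =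
      ∫ t in (0 : ℝ)..1, (K (a + u + t • v) v - K (a + t • u + t • v) v) := by
    rw [intervalIntegral_triangle_swap (g := fun s t => K' (a + s • u + t • v) u v) hc1]
    refine integral_congr fun t _ => ?_
    rw [integral_eq_sub_of_hasDerivAt (fun s _ => hs s t)
      ((hc1.comp (by fun_prop : Continuous fun s : ℝ => (s, t))).intervalIntegrable _ _), one_smul]
  have e2 : ∫ s in (0 : ℝ)..1, ∫ t in (0 : ℝ)..s, K' (a + s • u + t • v) v u =
      ∫ s in (0 : ℝ)..1, (K (a + s • u + s • v) u - K (a + s • u) u) := by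
    refine integral_congr fun s _ => ?_
    rw [integral_eq_sub_of_hasDerivAt (fun t _ => ht s t)
      ((hc2.comp (by fun_prop : Continuous fun t : ℝ => (s, t))).intervalIntegrable _ _),
      zero_smul, add_zero]
  have e3 (s : ℝ) : ∫ t in (0 : ℝ)..s,
      (K' (a + s • u + t • v) u v - K' (a + s • u + t • v) v u) =
      (∫ t in (0 : ℝ)..s, K' (a + s • u + t • v) u v) -
        ∫ t in (0 : ℝ)..s, K' (a + s • u + t • v) v u :=
    integral_sub ((hc1.comp (by fun_prop : Continuous fun t : ℝ => (s, t))).intervalIntegrable _ _)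
      ((hc2.comp (by fun_prop : Continuous fun t : ℝ => (s, t))).intervalIntegrable _ _)
  have ci {f : ℝ → ℝ} (hf : Continuous f) : IntervalIntegrable f volume 0 1 :=
    hf.intervalIntegrable _ _
  simp_rw [e3]
  rw [integral_sub (ci (continuous_parametric_intervalIntegral_of_continuous
      (f := fun s t : ℝ => K' (a + s • u + t • v) u v) hc1 (s := fun s => s) continuous_id))
    (ci (continuous_parametric_intervalIntegral_of_continuous
      (f := fun s t : ℝ => K' (a + s • u + t • v) v u) hc2 (s := fun s => s) continuous_id)), e1, e2,
    integral_sub (ci (by fun_prop)) (ci (by fun_prop)),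
    integral_sub (ci (by fun_prop)) (ci (by fun_prop))]
  -- The two leftover terms of `e1` and `e2` on the diagonal are the `v`- and `u`-parts of the
  -- integral along the hypotenuse.
  have e4 : ∫ s in (0 : ℝ)..1, K (a + s • (u + v)) (u + v) =
      (∫ s in (0 : ℝ)..1, K (a + s • u + s • v) u) +
        ∫ s in (0 : ℝ)..1, K (a + s • u + s • v) v := by
    rw [← integral_add (ci (by fun_prop)) (ci (by fun_prop))]
    refine integral_congr fun s _ => ?_
    simp [smul_add, add_assoc]
  rw [e4]
  ring

end Stokes

/-! ### Stokes' theorem for continuous forms with weak exterior derivative -/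

section Mollification

open Convolution

variable {d : ℕ}

/-- Mollifying a one-form and its distributional exterior derivative by a test function `g` yields
forms for which Stokes' theorem on triangles holds. -/
theorem stokes_triangle_mollified {A : Euc d → (Euc d →L[ℝ] ℝ)} (hA : Continuous A)
    {β : Euc d → Euc d [⋀^Fin 2]→L[ℝ] ℝ} (h : IsVectorPotential A β) {g : Euc d → ℝ}
    (hg : ContDiff ℝ ((⊤ : ℕ∞) : WithTop ℕ∞) g) (hgc : HasCompactSupport g) (a u v : Euc d) :
    ∫ s in (0 : ℝ)..1, ∫ t in (0 : ℝ)..s,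
        ∫ y, g y * β (a + s • u + t • v - y) ![u, v] =
      (∫ s in (0 : ℝ)..1, ∫ y, g y * A (a + s • u - y) u) +
        (∫ t in (0 : ℝ)..1, ∫ y, g y * A (a + u + t • v - y) v) -
        ∫ s in (0 : ℝ)..1, ∫ y, g y * A (a + s • (u + v) - y) (u + v) := by
  let L : (Euc d →L[ℝ] ℝ) →L[ℝ] ℝ →L[ℝ] (Euc d →L[ℝ] ℝ) := (ContinuousLinearMap.lsmul ℝ ℝ).flip
  have hg1 : ContDiff ℝ 1 g := hg.of_le (by exact_mod_cast le_top)
  have hAl : LocallyIntegrable A := hA.locallyIntegrable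
  let K : Euc d → (Euc d →L[ℝ] ℝ) := A ⋆[L, volume] g
  let K' : Euc d → Euc d →L[ℝ] (Euc d →L[ℝ] ℝ) := fderiv ℝ K
  have hKd : ContDiff ℝ 1 K := hgc.contDiff_convolution_right L hAl hg1
  have hK (x : Euc d) : HasFDerivAt K (K' x) x := (hKd.differentiable one_ne_zero x).hasFDerivAt
  have hK' : Continuous K' := hKd.continuous_fderiv one_ne_zero
  have hint {f : Euc d → (Euc d →L[ℝ] ℝ)} (hf : Continuous f) {k : Euc d → ℝ} (hk : Continuous k)
      (hkc : HasCompactSupport k) : Integrable fun y => k y • f y :=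
    (hk.smul hf).integrable_of_hasCompactSupport hkc.smul_right
  have hKe (x w : Euc d) : K x w = ∫ y, g y * A (x - y) w := by
    have : K x = ∫ y, g y • A (x - y) := convolution_eq_swap L
    rw [this, ContinuousLinearMap.integral_apply
      (hint (f := fun y => A (x - y)) (hA.comp (by fun_prop)) hg1.continuous hgc)]
    rfl
  have hcs (x w : Euc d) : HasCompactSupport fun t => fderiv ℝ g (x - t) w := by
    exact ((hgc.fderiv_apply ℝ w).comp_homeomorph (Homeomorph.subLeft x))
  have hcd (x w : Euc d) : Continuous fun t => fderiv ℝ g (x - t) w :=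
    ((hg1.continuous_fderiv one_ne_zero).comp (continuous_const.sub continuous_id)).clm_apply
      continuous_const
  have hK'e (x w z : Euc d) : K' x w z = ∫ t, fderiv ℝ g (x - t) w * A t z := by
    have : K' x w = ∫ t, fderiv ℝ g (x - t) w • A t := by
      rw [(hK x).unique (hgc.hasFDerivAt_convolution_right L hAl hg1 x)]
      exact convolution_precompR_apply L hAl (hgc.fderiv ℝ) (hg1.continuous_fderiv one_ne_zero) x w
    rw [this, ContinuousLinearMap.integral_apply (hint hA (hcd x w) (hcs x w))]
    rfl
  -- The weak equation is tested against `q ↦ g (x - q)`. The sign from the reflection turns its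
  -- right side into the antisymmetrised derivative of the mollified form.
  have key (x : Euc d) : ∫ y, g y * β (x - y) ![u, v] = K' x u v - K' x v u := by
    have h1 : ∫ y, g y * β (x - y) ![u, v] = ∫ q, β q ![u, v] * g (x - q) := by
      rw [← integral_sub_left_eq_self (fun q => β q ![u, v] * g (x - q)) volume x]
      simp [mul_comm]
    have hd (q w : Euc d) : fderiv ℝ (fun q => g (x - q)) q w = - fderiv ℝ g (x - q) w := by
      have h1 : HasFDerivAt (fun q => g (x - q)) _ q := (((hg1.differentiable one_ne_zero) (x - q)).hasFDerivAt).comp q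
        ((hasFDerivAt_id (𝕜 := ℝ) q).const_sub x)
      rw [h1.fderiv]
      simp
    have hi (w z : Euc d) : Integrable fun t => fderiv ℝ g (x - t) w * A t z :=
      ((hcd x w).mul (hA.clm_apply continuous_const)).integrable_of_hasCompactSupport
        (hcs x w).mul_right
    rw [h1, h (fun q => g (x - q)) (hg.comp (contDiff_const.sub contDiff_id))
      (hgc.comp_homeomorph (Homeomorph.subLeft x)) u v, hK'e, hK'e, ← integral_sub (hi u v) (hi v u)]
    refine integral_congr_ae (Filter.Eventually.of_forall fun q => ?_)
    simp only [hd]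
    ring
  simp_rw [key, ← hKe]
  exact stokes_triangle_of_hasFDerivAt hK hK' a u v

/-- Stokes' theorem on triangles for a continuous form whose distributional exterior derivative is
continuous. -/
theorem stokes_triangle {A : Euc d → (Euc d →L[ℝ] ℝ)} (hA : Continuous A)
    {β : Euc d → Euc d [⋀^Fin 2]→L[ℝ] ℝ} (hβ : Continuous β) (h : IsVectorPotential A β)
    (a u v : Euc d) :
    ∫ s in (0 : ℝ)..1, ∫ t in (0 : ℝ)..s, β (a + s • u + t • v) ![u, v] =
      (∫ s in (0 : ℝ)..1, A (a + s • u) u) + (∫ t in (0 : ℝ)..1, A (a + u + t • v) v) -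
        ∫ s in (0 : ℝ)..1, A (a + s • (u + v)) (u + v) := by
  obtain ⟨ρ⟩ : Nonempty (ContDiffBump (0 : Euc d)) := inferInstance
  let φ : Euc d → ℝ := ρ.normed volume
  have hφ : ContDiff ℝ ((⊤ : ℕ∞) : WithTop ℕ∞) φ := ρ.contDiff_normed
  have hφc : HasCompactSupport φ := ρ.hasCompactSupport_normed
  have hβ' : Continuous fun q => β q ![u, v] := hβ.eval continuous_const
  have hmoll {f : Euc d → ℝ} (hf : Continuous f) :
      Continuous fun p : ℝ × Euc d => ∫ y, φ y * f (p.2 - p.1 • y) := by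
    have : (fun p : ℝ × Euc d => ∫ y, φ y * f (p.2 - p.1 • y)) =
        fun p : ℝ × Euc d => ∫ y in tsupport φ, φ y * f (p.2 - p.1 • y) := by
      ext p
      refine (setIntegral_eq_integral_of_forall_compl_eq_zero fun y hy => ?_).symm
      simp [image_eq_zero_of_notMem_tsupport hy]
    rw [this]
    have := hφ.continuous
    refine continuous_parametric_integral_of_continuous ?_ hφc
    fun_prop
  have hA' (w : Euc d) : Continuous fun q => A q w := hA.clm_apply continuous_const
  -- The defect in Stokes' formula at mollification scale `ε`. Keeping the bump fixed and scaling
  -- its argument makes the expression meaningful and continuous at `ε = 0`, where it is the defect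
  -- of the original forms.
  let S : ℝ → ℝ := fun ε =>
    (∫ s in (0 : ℝ)..1, ∫ t in (0 : ℝ)..s,
        ∫ y, φ y * β (a + s • u + t • v - ε • y) ![u, v]) -
      ((∫ s in (0 : ℝ)..1, ∫ y, φ y * A (a + s • u - ε • y) u) +
        (∫ t in (0 : ℝ)..1, ∫ y, φ y * A (a + u + t • v - ε • y) v) -
        ∫ s in (0 : ℝ)..1, ∫ y, φ y * A (a + s • (u + v) - ε • y) (u + v))
  have hline {f : Euc d → ℝ} (hf : Continuous f) (b w : Euc d) :
      Continuous fun ε : ℝ => ∫ s in (0 : ℝ)..1, ∫ y, φ y * f (b + s • w - ε • y) :=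
    intervalIntegral.continuous_parametric_intervalIntegral_of_continuous'
      (f := fun ε s => ∫ y, φ y * f (b + s • w - ε • y)) ((hmoll hf).comp (by fun_prop : Continuous fun p : ℝ × ℝ => (p.1, b + p.2 • w))) 0 1
  have hS : Continuous S := by
    refine Continuous.sub ?_ (((hline (hA' u) a u).add (hline (hA' v) (a + u) v)).sub
      (hline (hA' (u + v)) a (u + v)))
    refine intervalIntegral.continuous_parametric_intervalIntegral_of_continuous' ?_ 0 1
    exact intervalIntegral.continuous_parametric_intervalIntegral_of_continuous
      (X := ℝ × ℝ) (s := fun p => p.2)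
      (f := fun p t => ∫ y, φ y * β (a + p.2 • u + t • v - p.1 • y) ![u, v])
      ((hmoll hβ').comp (by fun_prop :
        Continuous fun p : (ℝ × ℝ) × ℝ => (p.1.1, a + p.1.2 • u + p.2 • v))) continuous_snd
  have hS0 (ε : ℝ) (hε : ε ≠ 0) : S ε = 0 := by
    -- The Jacobian of `y ↦ ε⁻¹ • y`: the substitution turns the scaled average into a convolution
    -- with a rescaled bump.
    let c : ℝ := |((ε⁻¹) ^ Module.finrank ℝ (Euc d))|
    have hsc (f : Euc d → ℝ) (x : Euc d) :
        ∫ y, φ y * f (x - ε • y) = ∫ y, (c * φ (ε⁻¹ • y)) * f (x - y) := by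
      have := Measure.integral_comp_smul volume (fun y => φ (ε⁻¹ • y) * f (x - y)) ε
      simp only [inv_smul_smul₀ hε] at this
      rw [this, smul_eq_mul, ← integral_const_mul]
      simp [c, mul_assoc]
    have hg : ContDiff ℝ ((⊤ : ℕ∞) : WithTop ℕ∞) fun y => c * φ (ε⁻¹ • y) :=
      contDiff_const.mul (hφ.comp (contDiff_const_smul ε⁻¹))
    have hgc : HasCompactSupport fun y => c * φ (ε⁻¹ • y) :=
      (hφc.comp_smul (inv_ne_zero hε)).mul_left
    have := stokes_triangle_mollified hA h hg hgc a u v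
    simp only [S]
    simp_rw [hsc (fun q => β q ![u, v]), hsc (fun q => A q u), hsc (fun q => A q v),
      hsc (fun q => A q (u + v))]
    rw [this, sub_self]
  have hS00 : S 0 = 0 := by
    have h1 : Set.EqOn S 0 (closure {0}ᶜ) :=
      Set.EqOn.closure (fun ε hε => hS0 ε hε) hS continuous_const
    exact h1 (by rw [closure_compl_singleton]; trivial)
  have hone (r : ℝ) : ∫ y, φ y * r = r := by
    rw [integral_mul_const, ρ.integral_normed, one_mul]
  simp only [S, zero_smul, sub_zero, hone] at hS00
  linarith

end Mollification

/-! ### Real structures on twisted crossed products -/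

namespace TwistedSystem

variable {d : ℕ} {𝒜 : Type*} [CommCStarAlgebra 𝒜] {S : TwistedSystem d 𝒜}

/-- A norm-continuous family of unitaries `m` which intertwines the cocycle `σ` with its adjoint:
`m(x + y) σ(x, y)^* = m(x) α_x(m(y)) σ(x, y)`. -/
structure ConjugationPhase (S : TwistedSystem d 𝒜) where
  toFun : Euc d → 𝒜
  continuous_toFun : Continuous toFun
  star_mul_self : ∀ x, star (toFun x) * toFun x = 1
  map_add : ∀ x y,
    toFun (x + y) * star (S.cocycle x y) = toFun x * S.act x (toFun y) * S.cocycle x y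

namespace ConjugationPhase

variable (m : S.ConjugationPhase)

theorem mem_unitary (x : Euc d) : m.toFun x ∈ unitary 𝒜 :=
  Unitary.mem_iff.mpr ⟨m.star_mul_self x, by rw [mul_comm]; exact m.star_mul_self x⟩

theorem map_zero : m.toFun 0 = 1 := by
  have h := m.map_add 0 0
  rw [add_zero, S.cocycle_zero_left, star_one, mul_one, mul_one, S.act_zero] at h
  calc m.toFun 0 = star (m.toFun 0) * (m.toFun 0 * m.toFun 0) := by
        rw [← mul_assoc, m.star_mul_self, one_mul]
    _ = 1 := by rw [← h, m.star_mul_self]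

/-- This is `map_add` at the pair `x, -x`, where the cocycle is trivial. It is what lets `conj`
commute with the involution. -/
theorem star_act_neg (x : Euc d) : star (S.act x (m.toFun (-x))) = m.toFun x := by
  have h := m.map_add x (-x)
  rw [add_neg_cancel, m.map_zero, S.cocycle_neg, star_one, mul_one, mul_one] at h
  have h2 : star (S.act x (m.toFun (-x))) * S.act x (m.toFun (-x)) = 1 := by
    rw [← map_star, ← map_mul, m.star_mul_self, map_one]
  calc _ = star (S.act x (m.toFun (-x))) * (m.toFun x * S.act x (m.toFun (-x))) := by
        rw [← h, mul_one]
    _ = m.toFun x * (star (S.act x (m.toFun (-x))) * S.act x (m.toFun (-x))) := by ring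
    _ = _ := by rw [h2, mul_one]

/-- The map `F ↦ (z ↦ F(z)^* m(z))` on `C_c(ℝ^d, 𝒜)`. -/
def conj (F : S.ConvAlg) : S.ConvAlg :=
  ConvAlg.mk (fun z => star (F z) * m.toFun z) (F.continuous.star.mul m.continuous_toFun)
    (HasCompactSupport.mul_right
      (F.hasCompactSupport.comp_left (g := star) (star_zero 𝒜)))

theorem conj_apply (F : S.ConvAlg) (z : Euc d) : m.conj F z = star (F z) * m.toFun z := rfl

theorem conj_add (F G : S.ConvAlg) : m.conj (F + G) = m.conj F + m.conj G := by
  ext z; simp [conj_apply, add_mul]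

theorem conj_smul (c : ℂ) (F : S.ConvAlg) : m.conj (c • F) = star c • m.conj F := by
  ext z; simp [conj_apply]

theorem conj_conj (F : S.ConvAlg) : m.conj (m.conj F) = F := by
  ext z
  simp only [conj_apply, star_mul, star_star]
  rw [mul_comm (star (m.toFun z)), mul_assoc, m.star_mul_self, mul_one]

/-- Under the integral, conjugation replaces the cocycle by its adjoint, and `map_add` for the pair
`y, x - y` trades it back. Commutativity of `𝒜` lets the factors be regrouped. -/
theorem conj_mul (F G : S.ConvAlg) : m.conj (F * G) = m.conj F * m.conj G := by
  ext x
  rw [conj_apply, ConvAlg.mul_apply, ConvAlg.mul_apply]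
  have h1 : star (∫ y, ConvAlg.integrand F G x y) = ∫ y, star (ConvAlg.integrand F G x y) :=
    ((starL' ℝ : 𝒜 ≃L[ℝ] 𝒜).integral_comp_comm _).symm
  have h2 : (∫ y, star (ConvAlg.integrand F G x y)) * m.toFun x =
      ∫ y, star (ConvAlg.integrand F G x y) * m.toFun x :=
    (((ContinuousLinearMap.mul ℝ 𝒜).flip (m.toFun x)).integral_comp_comm
      ((starL' ℝ : 𝒜 ≃L[ℝ] 𝒜).integrable_comp_iff.mpr (ConvAlg.integrable_integrand F G x))).symm
  rw [h1, h2]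
  refine integral_congr_ae (Filter.Eventually.of_forall fun y => ?_)
  have h := m.map_add y (x - y)
  rw [add_sub_cancel] at h
  simp only [ConvAlg.integrand, conj_apply, star_mul, _root_.map_mul, map_star]
  calc _ = star (F y) * star (S.act y (G (x - y))) *
        (m.toFun x * star (S.cocycle y (x - y))) := by ring
    _ = _ := by rw [h]; ring

theorem conj_star (F : S.ConvAlg) : m.conj (star F) = star (m.conj F) := by
  ext x
  simp only [conj_apply, ConvAlg.star_apply, star_star, _root_.map_mul, star_mul, map_star,
    m.star_act_neg]
  ring

theorem norm_conj_apply (F : S.ConvAlg) (z : Euc d) : ‖m.conj F z‖ = ‖F z‖ := by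
  rw [conj_apply, CStarRing.norm_mul_mem_unitary _ (m.mem_unitary z), norm_star]

/-- The pull back of a seminorm on `C_c(ℝ^d, 𝒜)` along `conj`. -/
def pullback (p : Seminorm ℂ S.ConvAlg) : Seminorm ℂ S.ConvAlg :=
  Seminorm.of (fun F => p (m.conj F))
    (fun F G => by rw [m.conj_add]; exact map_add_le_add p _ _)
    (fun c F => by rw [m.conj_smul, map_smul_eq_mul, norm_star])

theorem pullback_apply (p : Seminorm ℂ S.ConvAlg) (F : S.ConvAlg) :
    m.pullback p F = p (m.conj F) := rfl

theorem isCStarSeminorm_pullback {p : Seminorm ℂ S.ConvAlg} (hp : ConvAlg.IsCStarSeminorm p) :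
    ConvAlg.IsCStarSeminorm (m.pullback p) where
  mul_le F G := by
    simp only [pullback_apply, conj_mul]; exact hp.mul_le _ _
  star_mul_self F := by
    simp only [pullback_apply, conj_mul, conj_star]; exact hp.star_mul_self _
  le_L1 F := by
    simpa only [pullback_apply, norm_conj_apply] using hp.le_L1 (m.conj F)

/-- The pulled back universal norm is again an admissible C*-seminorm, so maximality makes `conj` a
contraction. An involutive contraction is isometric. -/
theorem norm_conj (F : S.ConvAlg) : ‖m.conj F‖ = ‖F‖ := by
  have key (G : S.ConvAlg) : ‖m.conj G‖ ≤ ‖G‖ :=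
    ConvAlg.le_universalNorm (m.isCStarSeminorm_pullback ConvAlg.isCStarSeminorm_universalNorm) G
  exact le_antisymm (key F) (by simpa only [conj_conj] using key (m.conj F))

theorem uniformContinuous_conj : UniformContinuous m.conj :=
  (AddMonoidHomClass.isometry_of_norm (AddMonoidHom.mk' m.conj m.conj_add)
    m.norm_conj).uniformContinuous

/-- The extension of `conj` to the crossed product. -/
def conjExtend : S.CrossedProduct → S.CrossedProduct :=
  UniformSpace.Completion.map m.conj

theorem conjExtend_of (F : S.ConvAlg) :
    m.conjExtend (CrossedProduct.of S F) = CrossedProduct.of S (m.conj F) :=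
  UniformSpace.Completion.map_coe m.uniformContinuous_conj F

theorem continuous_conjExtend : Continuous m.conjExtend :=
  UniformSpace.Completion.continuous_map

theorem isRealStructure_conjExtend : IsRealStructure m.conjExtend where
  map_add a b := by
    have := m.continuous_conjExtend
    induction a, b using CrossedProduct.ind₂ with
    | hc => exact isClosed_eq (by fun_prop) (by fun_prop)
    | h F G => simp only [← _root_.map_add, conjExtend_of, conj_add]
  map_smul c a := by
    have := m.continuous_conjExtend
    induction a using CrossedProduct.ind₁ with
    | hc => exact isClosed_eq (this.comp (continuous_id.const_smul c)) (this.const_smul (star c))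
    | h F => simp only [← _root_.map_smul, conjExtend_of, conj_smul]
  map_mul a b := by
    have := m.continuous_conjExtend
    induction a, b using CrossedProduct.ind₂ with
    | hc => exact isClosed_eq (by fun_prop) (by fun_prop)
    | h F G => simp only [← CrossedProduct.of_mul, conjExtend_of, conj_mul]
  map_star a := by
    have := m.continuous_conjExtend
    induction a using CrossedProduct.ind₁ with
    | hc => exact isClosed_eq (by fun_prop) (by fun_prop)
    | h F => simp only [← CrossedProduct.of_star, conjExtend_of, conj_star]
  involutive a := by
    have := m.continuous_conjExtend
    induction a using CrossedProduct.ind₁ with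
    | hc => exact isClosed_eq (by fun_prop) (by fun_prop)
    | h F => simp only [conjExtend_of, conj_conj]
  norm_map a := by
    have := m.continuous_conjExtend
    induction a using CrossedProduct.ind₁ with
    | hc => exact isClosed_eq (by fun_prop) (by fun_prop)
    | h F => rw [conjExtend_of, LinearIsometry.norm_map, LinearIsometry.norm_map, norm_conj]

end ConjugationPhase

end TwistedSystem

/-! ### Phases of line integrals -/

section Angle

variable {d : ℕ}

/-- The line integral of `A` along the segment `[q, q + x]`. -/
def segmentIntegral (A : Euc d → (Euc d →L[ℝ] ℝ)) (x q : Euc d) : ℝ :=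
  ∫ s in (0 : ℝ)..1, A (q + s • x) x

theorem gaugePhase_eq (A : Euc d → (Euc d →L[ℝ] ℝ)) (x q : Euc d) :
    gaugePhase A x q = Complex.exp (-Complex.I * segmentIntegral A x q) := by
  simp [gaugePhase, segmentIntegral, curveIntegral_segment, AffineMap.lineMap_apply, add_comm]

theorem norm_gaugePhase (A : Euc d → (Euc d →L[ℝ] ℝ)) (x q : Euc d) : ‖gaugePhase A x q‖ = 1 := by
  rw [gaugePhase_eq, Complex.norm_exp]
  simp

theorem star_mul_gaugePhase (A : Euc d → (Euc d →L[ℝ] ℝ)) (x q : Euc d) :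
    star (gaugePhase A x q) * gaugePhase A x q = 1 := by
  rw [Complex.star_def, Complex.conj_mul', norm_gaugePhase]
  simp

theorem gaugePhase_zpow_neg_two (A : Euc d → (Euc d →L[ℝ] ℝ)) (x q : Euc d) :
    gaugePhase A x q ^ (-2 : ℤ) = star (gaugePhase A x q) * star (gaugePhase A x q) := by
  have h := star_mul_gaugePhase A x q
  rw [zpow_neg, inv_eq_of_mul_eq_one_left]
  rw [show (2 : ℤ) = ((2 : ℕ) : ℤ) from rfl, zpow_natCast, sq]
  linear_combination (star (gaugePhase A x q) * gaugePhase A x q + 1) * h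

variable {A : Euc d → (Euc d →L[ℝ] ℝ)}

theorem continuous_segmentIntegral_comp (hA : Continuous A) {X : Type*} [TopologicalSpace X]
    [FirstCountableTopology X] {u v : X → Euc d} (hu : Continuous u) (hv : Continuous v) :
    Continuous fun p => segmentIntegral A (u p) (v p) :=
  intervalIntegral.continuous_parametric_intervalIntegral_of_continuous'
    (f := fun p s => A (v p + s • u p) (u p)) (by fun_prop) 0 1

theorem segmentIntegral_zero (q : Euc d) : segmentIntegral A 0 q = 0 := by
  simp [segmentIntegral]

/-- If the phases `exp(-i k ∫ A)` over the segments `[q, q + t z]`, `0 ≤ t ≤ 1`, are all close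
to `1`, then no branch of the logarithm is crossed. -/
theorem abs_segmentIntegral_lt (hA : Continuous A) {k : ℝ} {z q : Euc d}
    (h : ∀ t ∈ Set.Icc (0 : ℝ) 1,
      ‖Complex.exp (-Complex.I * (k * segmentIntegral A (t • z) q : ℝ)) - 1‖ ≤ 1 / 2) :
    |k * segmentIntegral A z q| < Real.pi / 2 := by
  let θ : ℝ → ℝ := fun t => k * segmentIntegral A (t • z) q
  have hθ : Continuous θ :=
    continuous_const.mul (continuous_segmentIntegral_comp hA (by fun_prop) continuous_const)
  by_contra! hcon
  have h0 : |θ 0| = 0 := by simp [θ, segmentIntegral_zero]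
  have h1 : Real.pi / 2 ≤ |θ 1| := by simpa [θ] using hcon
  -- If the angle ever reached `π/2` in absolute value, the phase there would have real part `0` and
  -- so lie at distance at least `1` from `1`.
  obtain ⟨t, ht, hte⟩ := intermediate_value_Icc zero_le_one hθ.abs.continuousOn
    (show Real.pi / 2 ∈ Set.Icc |θ 0| |θ 1| from ⟨by rw [h0]; positivity, h1⟩)
  have hre := (Complex.abs_re_le_norm _).trans (h t ht)
  have hcos : (Complex.exp (-Complex.I * (θ t : ℝ)) - 1).re = Real.cos |θ t| - 1 := by
    rw [Real.cos_abs, Complex.sub_re, Complex.exp_re]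
    simp
  rw [hcos] at hre
  simp only at hte
  rw [hte, Real.cos_pi_div_two] at hre
  norm_num at hre

theorem log_exp_segmentIntegral {k : ℝ} {z q : Euc d}
    (h : |k * segmentIntegral A z q| < Real.pi / 2) :
    Complex.log (Complex.exp (-Complex.I * (k * segmentIntegral A z q : ℝ))) =
      -Complex.I * (k * segmentIntegral A z q : ℝ) := by
  obtain ⟨h1, h2⟩ := abs_lt.1 h
  have hpi := Real.pi_pos
  apply Complex.log_exp <;> simp <;> linarith

end Angle

/-! ### The phases trivialise the magnetic cocycle -/

section Cocycle

variable {d : ℕ} {Ω : Type*} [TopologicalSpace Ω] [CompactSpace Ω]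
  [TopologicalSpace.MetrizableSpace Ω] [AddAction (Euc d) Ω] [ContinuousVAdd (Euc d) Ω]

theorem MagneticField.continuous_fieldAt (B : MagneticField d Ω) (ω : Ω) :
    Continuous (B.fieldAt ω) := by
  have := B.continuous_toFun
  unfold MagneticField.fieldAt
  fun_prop

variable {B : MagneticField d Ω} {ω₀ : Ω} {A : Euc d → (Euc d →L[ℝ] ℝ)}

theorem flux_eq_segmentIntegral (hA : Continuous A) (hBA : IsVectorPotential A (B.fieldAt ω₀))
    (x y q : Euc d) : B.flux ω₀ q (q + x) (q + x + y) =
      segmentIntegral A x q + segmentIntegral A y (q + x) - segmentIntegral A (x + y) q := by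
  rw [MagneticField.flux, triangleFlux, add_sub_cancel_left, add_sub_cancel_left]
  exact stokes_triangle hA (B.continuous_fieldAt ω₀) hBA q x y

theorem gaugePhase_mul (hA : Continuous A) (hBA : IsVectorPotential A (B.fieldAt ω₀))
    (x y q : Euc d) : gaugePhase A x q * gaugePhase A y (q + x) =
      (B.orbitCocycle ω₀ x y : Euc d →ᵇ ℂ) q * gaugePhase A (x + y) q := by
  rw [MagneticField.orbitCocycle_apply, flux_eq_segmentIntegral hA hBA, gaugePhase_eq,
    gaugePhase_eq, gaugePhase_eq, ← Complex.exp_add, ← Complex.exp_add]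
  congr 1
  push_cast
  ring

/-- The degenerate triangle `q, q + z, q + 2z` carries no flux, as an alternating form vanishes on
`(z, z)`. -/
theorem segmentIntegral_two_smul (hA : Continuous A) (hBA : IsVectorPotential A (B.fieldAt ω₀))
    (z q : Euc d) : segmentIntegral A ((2 : ℝ) • z) q =
      segmentIntegral A z q + segmentIntegral A z (q + z) := by
  have h := stokes_triangle hA (B.continuous_fieldAt ω₀) hBA q z z
  have h0 (p : Euc d) : B.fieldAt ω₀ p ![z, z] = 0 :=
    (B.fieldAt ω₀ p).map_eq_zero_of_eq ![z, z] (i := 0) (j := 1) rfl (by simp)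
  simp only [h0, intervalIntegral.integral_zero] at h
  rw [two_smul]
  simp only [segmentIntegral]
  linarith

end Cocycle

/-! ### Functions on the orbit -/

section Orbit

variable {d : ℕ} {Ω : Type*} [TopologicalSpace Ω] [CompactSpace Ω]
  [TopologicalSpace.MetrizableSpace Ω] [AddAction (Euc d) Ω] [ContinuousVAdd (Euc d) Ω] {ω₀ : Ω}

theorem memOrbitAlgebra_iff {g : Euc d → ℂ} :
    MemOrbitAlgebra ω₀ g ↔ ∃ f : C(Ω, ℂ), ∀ q : Euc d, f (-q +ᵥ ω₀) = g q := by
  constructor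
  · rintro ⟨_, ⟨f, rfl⟩, h⟩
    exact ⟨f, h⟩
  · rintro ⟨f, h⟩
    exact ⟨_, ⟨f, rfl⟩, h⟩

namespace MemOrbitAlgebra

theorem comp_add {g : Euc d → ℂ} (hg : MemOrbitAlgebra ω₀ g) (x : Euc d) :
    MemOrbitAlgebra ω₀ fun q => g (q + x) := by
  rw [memOrbitAlgebra_iff] at *
  obtain ⟨f, hf⟩ := hg
  refine ⟨hullShift d x f, fun q => ?_⟩
  rw [← hf]
  simp only [hullShift, ContinuousMap.comp_apply, ContinuousMap.coe_mk, ← add_vadd]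
  congr 2
  abel

theorem comp {g : Euc d → ℂ} (hg : MemOrbitAlgebra ω₀ g) {k : ℂ → ℂ} (hk : Continuous k) :
    MemOrbitAlgebra ω₀ fun q => k (g q) := by
  rw [memOrbitAlgebra_iff] at *
  obtain ⟨f, hf⟩ := hg
  exact ⟨(⟨k, hk⟩ : C(ℂ, ℂ)).comp f, fun q => by simp [hf]⟩

/-- Density of the orbit spreads the bound to all of Ω, so the representing function has values in
the slit plane and its logarithm is continuous on Ω. -/
theorem log (hω₀ : Dense (Set.range fun x : Euc d => x +ᵥ ω₀)) {g : Euc d → ℂ}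
    (hg : MemOrbitAlgebra ω₀ g) (h1 : ∀ q, ‖g q - 1‖ ≤ 1 / 2) :
    MemOrbitAlgebra ω₀ fun q => Complex.log (g q) := by
  rw [memOrbitAlgebra_iff] at *
  obtain ⟨f, hf⟩ := hg
  have hf1 (ω : Ω) : ‖f ω - 1‖ ≤ 1 / 2 := by
    have hcl : IsClosed {ω : Ω | ‖f ω - 1‖ ≤ 1 / 2} := isClosed_le (by fun_prop) continuous_const
    refine hcl.closure_subset_iff.2 ?_ (hω₀ ω)
    rintro _ ⟨x, rfl⟩
    have := h1 (-x)
    rwa [← hf, neg_neg] at this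
  have hs (ω : Ω) : f ω ∈ Complex.slitPlane := by
    left
    have := (abs_le.1 ((Complex.abs_re_le_norm _).trans (hf1 ω))).1
    rw [Complex.sub_re, Complex.one_re] at this
    linarith
  exact ⟨⟨fun ω => Complex.log (f ω), f.continuous.clog hs⟩, fun q => by simp [hf]⟩

theorem of_uniform_limit {h : Euc d → ℂ} (hc : Continuous h)
    (H : ∀ ε > 0, ∃ g, MemOrbitAlgebra ω₀ g ∧ ∀ q, ‖g q - h q‖ ≤ ε) :
    MemOrbitAlgebra ω₀ h := by
  -- One approximant, at distance `1`, already shows that `h` is bounded.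
  obtain ⟨_, ⟨g, -, hg⟩, hgh⟩ := H 1 one_pos
  have hb (q : Euc d) : ‖h q‖ ≤ ‖g‖ + 1 := by
    have h1 := norm_sub_norm_le (h q) (g q)
    rw [norm_sub_rev, hg] at h1
    have h2 := g.norm_coe_le_norm q
    rw [hg] at h2
    linarith [hgh q]
  let k : Euc d →ᵇ ℂ := BoundedContinuousFunction.ofNormedAddCommGroup h hc _ hb
  refine ⟨k, ?_, fun q => rfl⟩
  refine (isClosed_orbitAlgebra d ω₀).closure_subset (Metric.mem_closure_iff.2 fun ε hε => ?_)
  obtain ⟨_, ⟨f, hf, hfe⟩, hfh⟩ := H (ε / 2) (half_pos hε)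
  refine ⟨f, hf, lt_of_le_of_lt ?_ (half_lt_self hε)⟩
  rw [dist_comm]
  refine (BoundedContinuousFunction.dist_le (half_pos hε).le).2 fun q => ?_
  rw [dist_eq_norm, hfe]
  exact hfh q

/-- Translation acts norm continuously on `C(Ω)`, by compactness of Ω. Continuity at `0`, evaluated
at points of the orbit, is uniform continuity of `g`. -/
theorem uniformContinuous {g : Euc d → ℂ} (hg : MemOrbitAlgebra ω₀ g) : UniformContinuous g := by
  rw [memOrbitAlgebra_iff] at hg
  obtain ⟨f, hf⟩ := hg
  rw [Metric.uniformContinuous_iff]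
  intro ε hε
  obtain ⟨δ, hδ, h⟩ := Metric.continuous_iff.1 (continuous_hullShift d f) 0 ε hε
  refine ⟨δ, hδ, fun {a b} hab => ?_⟩
  have h1 := (ContinuousMap.dist_apply_le_dist (f := hullShift d (a - b) f)
    (g := hullShift d 0 f) (-b +ᵥ ω₀)).trans_lt (h (a - b) (by simpa [dist_eq_norm] using hab))
  simp only [hullShift, ContinuousMap.comp_apply, ContinuousMap.coe_mk, ← add_vadd] at h1
  rwa [show -(a - b) + -b = -a by abel, neg_zero, zero_add, hf, hf] at h1

end MemOrbitAlgebra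

/-- `C(Ω)` is separable for compact metrizable Ω, and 𝒞 is a continuous image of it. The Baire
argument for the phases needs the countable dense set. -/
instance separableSpace_orbitAlgebra :
    TopologicalSpace.SeparableSpace (orbitAlgebra d ω₀) := by
  let _ := TopologicalSpace.metrizableSpaceMetric Ω
  have hs : Function.Surjective fun f : C(Ω, ℂ) =>
      (⟨orbitHom d ω₀ f, f, rfl⟩ : orbitAlgebra d ω₀) := by
    rintro ⟨_, f, rfl⟩
    exact ⟨f, rfl⟩
  exact hs.denseRange.separableSpace ((continuous_orbitHom d ω₀).subtype_mk _)

end Orbit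

/-! ### Phases with values in the algebra of the orbit -/

section Phase

open Filter Topology

variable {d : ℕ} {Ω : Type*} [TopologicalSpace Ω] [CompactSpace Ω]
  [TopologicalSpace.MetrizableSpace Ω] [AddAction (Euc d) Ω] [ContinuousVAdd (Euc d) Ω]
  {B : MagneticField d Ω} {ω₀ : Ω} {A : Euc d → (Euc d →L[ℝ] ℝ)}

theorem norm_coe_sub_coe_le (f g : orbitAlgebra d ω₀) (q : Euc d) :
    ‖(f : Euc d →ᵇ ℂ) q - (g : Euc d →ᵇ ℂ) q‖ ≤ dist f g := by
  rw [← dist_eq_norm]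
  exact BoundedContinuousFunction.dist_coe_le_dist (f := (f : Euc d →ᵇ ℂ)) q

theorem continuous_gaugePhase_left (hA : Continuous A) (q : Euc d) :
    Continuous fun x => gaugePhase A x q := by
  simp only [gaugePhase_eq]
  have := continuous_segmentIntegral_comp hA (u := fun x : Euc d => x) (v := fun _ => q)
    continuous_id continuous_const
  fun_prop

theorem eventually_norm_orbitCocycle_sub_one_le (B : MagneticField d Ω) (ω₀ : Ω) (x : Euc d)
    {ε : ℝ} (hε : 0 < ε) :
    ∀ᶠ y in 𝓝 (0 : Euc d), ∀ q, ‖(B.orbitCocycle ω₀ x y : Euc d →ᵇ ℂ) q - 1‖ ≤ ε := by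
  have hc : Continuous fun y => B.orbitCocycle ω₀ x y :=
    (B.system ω₀).continuous_cocycle_comp continuous_const continuous_id
  have h := Metric.continuousAt_iff'.1 (hc.continuousAt (x := 0)) ε hε
  filter_upwards [h] with y hy q
  have h0 : B.orbitCocycle ω₀ x 0 = 1 := (B.system ω₀).cocycle_zero_right x
  rw [h0] at hy
  exact (norm_coe_sub_coe_le (B.orbitCocycle ω₀ x y) 1 q).trans hy.le

/-- Smallness of `λ(y) - 1` is converted into closeness of `λ(x + y)` and `λ(x)` at an arbitrary
base point `x`. The shift from `q` to `q + x` does not affect suprema over `q`. -/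
theorem norm_gaugePhase_sub_one (hA : Continuous A) (hBA : IsVectorPotential A (B.fieldAt ω₀))
    (x y q : Euc d) : ‖gaugePhase A y (q + x) - 1‖ =
      ‖(B.orbitCocycle ω₀ x y : Euc d →ᵇ ℂ) q * gaugePhase A (x + y) q - gaugePhase A x q‖ := by
  rw [← gaugePhase_mul hA hBA, ← mul_sub_one, norm_mul, norm_gaugePhase, one_mul]

/-- If all the phases `λ(z)` belong to `𝒞`, then `λ(y) → 1` uniformly as `y → 0`. -/
theorem eventually_norm_gaugePhase_sub_one_le (hA : Continuous A)
    (hBA : IsVectorPotential A (B.fieldAt ω₀))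
    (h : ∀ z : Euc d, MemOrbitAlgebra ω₀ (gaugePhase A z)) {ε : ℝ} (hε : 0 < ε) :
    ∀ᶠ y in 𝓝 (0 : Euc d), ∀ q, ‖gaugePhase A y q - 1‖ ≤ ε := by
  obtain ⟨c, hc⟩ := TopologicalSpace.exists_dense_seq (orbitAlgebra d ω₀)
  -- Baire's theorem applies to these sets: they are closed because each `λ(·)(q)` is continuous,
  -- and they cover since the `c n` are dense in 𝒞. On the interior of one of them λ varies by at
  -- most `2ε/3` uniformly in `q`; the cocycle accounts for the last `ε/3`.
  let K : ℕ → Set (Euc d) := fun n =>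
    {z | ∀ q, ‖gaugePhase A z q - (c n : Euc d →ᵇ ℂ) q‖ ≤ ε / 3}
  have hK (n : ℕ) : IsClosed (K n) := by
    simp only [K, Set.ofPred_forall]
    refine isClosed_iInter fun q => ?_
    exact isClosed_le ((continuous_gaugePhase_left hA q).sub continuous_const).norm
      continuous_const
  have hU : ⋃ n, K n = Set.univ := by
    refine Set.eq_univ_of_forall fun z => Set.mem_iUnion.2 ?_
    obtain ⟨f, hf, hfz⟩ := h z
    obtain ⟨n, hn⟩ := hc.exists_dist_lt (⟨f, hf⟩ : orbitAlgebra d ω₀)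
      (show 0 < ε / 3 by positivity)
    refine ⟨n, fun q => ?_⟩
    rw [← hfz]
    exact (norm_coe_sub_coe_le ⟨f, hf⟩ (c n) q).trans hn.le
  obtain ⟨n, x, hx⟩ := nonempty_interior_of_iUnion_of_closed hK hU
  have hev : ∀ᶠ y in 𝓝 (0 : Euc d), x + y ∈ K n := by
    have ht : Tendsto (fun y => x + y) (𝓝 (0 : Euc d)) (𝓝 x) := by
      have : Continuous fun y : Euc d => x + y := by fun_prop
      simpa using this.tendsto 0
    exact ht.eventually (mem_interior_iff_mem_nhds.1 hx)
  filter_upwards [hev, eventually_norm_orbitCocycle_sub_one_le B ω₀ x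
    (show 0 < ε / 3 by positivity)] with y hy hσ q
  have h1 := norm_gaugePhase_sub_one hA hBA x y (q - x)
  rw [sub_add_cancel] at h1
  rw [h1]
  have h2 := hy (q - x)
  have h3 := interior_subset hx (q - x)
  have h4 := hσ (q - x)
  generalize hs : (B.orbitCocycle ω₀ x y : Euc d →ᵇ ℂ) (q - x) = s at *
  generalize (c n : Euc d →ᵇ ℂ) (q - x) = w at *
  have e : s * gaugePhase A (x + y) (q - x) - gaugePhase A x (q - x) =
      (s - 1) * gaugePhase A (x + y) (q - x) + (gaugePhase A (x + y) (q - x) - w) -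
        (gaugePhase A x (q - x) - w) := by ring
  rw [e]
  refine (norm_sub_le _ _).trans ?_
  have h5 := norm_add_le ((s - 1) * gaugePhase A (x + y) (q - x))
    (gaugePhase A (x + y) (q - x) - w)
  rw [norm_mul, norm_gaugePhase, mul_one] at h5
  linarith

/-- If all the phases `λ(z)` belong to `𝒞`, then `z ↦ λ(z)` is norm continuous. -/
theorem continuous_of_eq_gaugePhase (hA : Continuous A)
    (hBA : IsVectorPotential A (B.fieldAt ω₀)) {l : Euc d → orbitAlgebra d ω₀}
    (hl : ∀ z q, (l z : Euc d →ᵇ ℂ) q = gaugePhase A z q) : Continuous l := by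
  have h (z : Euc d) : MemOrbitAlgebra ω₀ (gaugePhase A z) := ⟨l z, (l z).2, hl z⟩
  refine continuous_iff_continuousAt.2 fun x => Metric.continuousAt_iff'.2 fun ε hε => ?_
  have h1 := eventually_norm_gaugePhase_sub_one_le hA hBA h (show 0 < ε / 3 by positivity)
  have h2 := eventually_norm_orbitCocycle_sub_one_le B ω₀ x (show 0 < ε / 3 by positivity)
  have ht : Tendsto (fun y => y - x) (𝓝 x) (𝓝 (0 : Euc d)) := by
    have : Continuous fun y : Euc d => y - x := by fun_prop
    simpa using this.tendsto x
  filter_upwards [ht.eventually (h1.and h2)] with y hy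
  refine lt_of_le_of_lt ((BoundedContinuousFunction.dist_le (by positivity)).2 fun q => ?_)
    (show ε / 3 + ε / 3 < ε by linarith)
  rw [dist_eq_norm, hl, hl]
  have h3 := hy.1 (q + x)
  have h4 := hy.2 q
  rw [norm_gaugePhase_sub_one hA hBA, add_sub_cancel] at h3
  generalize (B.orbitCocycle ω₀ x (y - x) : Euc d →ᵇ ℂ) q = s at *
  have e : gaugePhase A y q - gaugePhase A x q =
      (s * gaugePhase A y q - gaugePhase A x q) - (s - 1) * gaugePhase A y q := by ring
  rw [e]
  refine (norm_sub_le _ _).trans ?_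
  rw [norm_mul, norm_gaugePhase, mul_one]
  linarith

/-- If all the phases `λ(z)` belong to `𝒞`, then the powers `λ(z)⁻²` define a real structure. -/
theorem definesRealStructure_of_memOrbitAlgebra (hA : Continuous A)
    (hBA : IsVectorPotential A (B.fieldAt ω₀))
    (h : ∀ z : Euc d, MemOrbitAlgebra ω₀ (gaugePhase A z)) : DefinesRealStructure B ω₀ A := by
  choose l hl hlz using h
  let L : Euc d → orbitAlgebra d ω₀ := fun z => ⟨l z, hl z⟩
  have hL : Continuous L := continuous_of_eq_gaugePhase hA hBA hlz
  have hLu (z : Euc d) : star (L z) * L z = 1 := by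
    ext q
    change star (l z q) * l z q = 1
    rw [hlz, star_mul_gaugePhase]
  have hLm (x y : Euc d) : L x * (B.system ω₀).act x (L y) =
      (B.system ω₀).cocycle x y * L (x + y) := by
    ext q
    change l x q * l y (q + x) = (B.orbitCocycle ω₀ x y : Euc d →ᵇ ℂ) q * l (x + y) q
    rw [hlz, hlz, hlz, gaugePhase_mul hA hBA]
  -- By unitarity this is λ⁻². Squaring the adjoint of `hLm` produces `(σ^*)²`, and the remaining
  -- factor `σ` cancels one of the two copies.
  let m : (B.system ω₀).ConjugationPhase :=
    { toFun := fun z => star (L z) * star (L z)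
      continuous_toFun := hL.star.mul hL.star
      star_mul_self := fun z => by
        rw [star_mul, star_star]
        linear_combination (star (L z) * L z + 1) * hLu z
      map_add := fun x y => by
        have hσ := (Unitary.mem_iff.mp ((B.system ω₀).cocycle_unitary x y)).1
        have e := hLm x y
        have e' := congrArg star e
        rw [star_mul, star_mul] at e'
        rw [map_mul, map_star]
        generalize (B.system ω₀).cocycle x y = σ at *
        generalize (B.system ω₀).act x (L y) = M at *
        have e2 : star (L x) * star (L x) * (star M * star M) * σ =
            (star M * star (L x)) * (star M * star (L x)) * σ := by ring
        rw [e2, e']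
        linear_combination (-(star (L (x + y)) * star (L (x + y)) * star σ)) * hσ }
  refine ⟨m.conjExtend, m.isRealStructure_conjExtend, fun F => ⟨m.conj F, fun z q => ?_,
    m.conjExtend_of F⟩⟩
  change star ((F z : Euc d →ᵇ ℂ) q) * (star (l z q) * star (l z q)) = _
  rw [gaugePhase_zpow_neg_two, hlz]

/-- If a power `λ(z)ᵏ` belongs to `𝒞` and is uniformly close to `1` for all small `z`, then the line
integrals of `A` along short segments belong to `𝒞`. -/
theorem memOrbitAlgebra_segmentIntegral (hω₀ : Dense (Set.range fun x : Euc d => x +ᵥ ω₀))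
    (hA : Continuous A) {k : ℕ} (hk : k ≠ 0)
    (hmem : ∀ z : Euc d, MemOrbitAlgebra ω₀ fun q => gaugePhase A z q ^ k)
    (hone : ∀ᶠ z in 𝓝 (0 : Euc d), ∀ q, ‖gaugePhase A z q ^ k - 1‖ ≤ 1 / 2) :
    ∃ δ > 0, ∀ z : Euc d, ‖z‖ < δ →
      MemOrbitAlgebra ω₀ fun q => (segmentIntegral A z q : ℂ) := by
  obtain ⟨δ, hδ, hball⟩ := Metric.eventually_nhds_iff.1 hone
  refine ⟨δ, hδ, fun z hz => ?_⟩
  have hpow (z q : Euc d) : gaugePhase A z q ^ k =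
      Complex.exp (-Complex.I * ((k : ℝ) * segmentIntegral A z q : ℝ)) := by
    rw [gaugePhase_eq, ← Complex.exp_nat_mul]
    congr 1
    push_cast
    ring
  have hlog := (hmem z).log hω₀ (hball (by simpa using hz))
  -- Multiplication by `I / k` inverts multiplication by `-I * k`, recovering the line integral from
  -- the logarithm.
  have hc : Continuous fun w : ℂ => Complex.I / k * w := by fun_prop
  convert hlog.comp hc using 2 with q
  rw [hpow, log_exp_segmentIntegral]
  · have : (k : ℂ) ≠ 0 := by exact_mod_cast hk
    push_cast
    field_simp
    simp
  -- The ball of radius `δ` is star-shaped about `0`, so the phase is near `1` along the whole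
  -- segment and the logarithm is the principal one.
  · refine abs_segmentIntegral_lt hA fun t ht => ?_
    rw [← hpow]
    refine hball ?_ q
    rw [dist_zero_right, norm_smul, Real.norm_eq_abs, abs_of_nonneg ht.1]
    exact (mul_le_of_le_one_left (norm_nonneg _) ht.2).trans_lt hz

/-- If the line integrals of `A` along short segments belong to `𝒞`, then so do all phases. -/
theorem memOrbitAlgebra_gaugePhase_of_segmentIntegral (hA : Continuous A)
    (hBA : IsVectorPotential A (B.fieldAt ω₀)) {δ : ℝ} (hδ : 0 < δ)
    (h : ∀ z : Euc d, ‖z‖ < δ → MemOrbitAlgebra ω₀ fun q => (segmentIntegral A z q : ℂ))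
    (z : Euc d) : MemOrbitAlgebra ω₀ (gaugePhase A z) := by
  -- Each step cuts a segment into two halves, one a translate of the other, and so doubles the
  -- admissible radius.
  have key (n : ℕ) : ∀ z : Euc d, ‖z‖ < 2 ^ n * δ →
      MemOrbitAlgebra ω₀ fun q => (segmentIntegral A z q : ℂ) := by
    induction n with
    | zero => simpa using h
    | succ n ih =>
      intro z hz
      have hz2 : ‖(2⁻¹ : ℝ) • z‖ < 2 ^ n * δ := by
        rw [norm_smul, norm_inv, Real.norm_ofNat, inv_mul_lt_iff₀ two_pos, ← mul_assoc,
          ← pow_succ']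
        exact hz
      have h1 := ih _ hz2
      have h2 := memOrbitAlgebra_iff.1 h1
      have h3 := memOrbitAlgebra_iff.1 (h1.comp_add ((2⁻¹ : ℝ) • z))
      obtain ⟨f, hf⟩ := h2
      obtain ⟨g, hg⟩ := h3
      refine memOrbitAlgebra_iff.2 ⟨f + g, fun q => ?_⟩
      have e := segmentIntegral_two_smul hA hBA ((2⁻¹ : ℝ) • z) q
      rw [smul_inv_smul₀ two_ne_zero] at e
      rw [ContinuousMap.add_apply, hf, hg, e]
      push_cast
      rfl
  obtain ⟨n, hn⟩ := pow_unbounded_of_one_lt (‖z‖ / δ) (one_lt_two (α := ℝ))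
  have hexp : Continuous fun w : ℂ => Complex.exp (-Complex.I * w) := by fun_prop
  convert (key n z ((div_lt_iff₀ hδ).1 hn)).comp hexp using 2 with q
  exact gaugePhase_eq A z q

/-- If `𝔣` defines a real structure, then all the phases `λ(z)` belong to `𝒞`. -/
theorem DefinesRealStructure.memOrbitAlgebra
    (hω₀ : Dense (Set.range fun x : Euc d => x +ᵥ ω₀)) (hA : Continuous A)
    (hBA : IsVectorPotential A (B.fieldAt ω₀)) (h : DefinesRealStructure B ω₀ A) (z : Euc d) :
    MemOrbitAlgebra ω₀ (gaugePhase A z) := by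
  -- Only the preservation of `C_c(ℝ^d, 𝒞)` by the formula is needed; the algebraic properties of
  -- `R` play no role.
  obtain ⟨R, -, hR⟩ := h
  have key (x : Euc d) : ∃ m : Euc d → orbitAlgebra d ω₀, Continuous m ∧
      ∀ᶠ z in 𝓝 x, ∀ q, (m z : Euc d →ᵇ ℂ) q = gaugePhase A z q ^ 2 := by
    obtain ⟨ρ⟩ : Nonempty (ContDiffBump x) := inferInstance
    -- A scalar bump equal to `1` near `x`: there its image under 𝔣 is λ⁻², whose adjoint is λ².
    let F₀ : Euc d → orbitAlgebra d ω₀ := fun z => ((ρ z : ℝ) : ℂ) • 1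
    have hF₀ : Continuous F₀ :=
      (Complex.continuous_ofReal.comp ρ.continuous).smul continuous_const
    have hF₀' : HasCompactSupport F₀ := by
      refine HasCompactSupport.intro ρ.hasCompactSupport.isCompact fun z hz => ?_
      simp only [F₀, image_eq_zero_of_notMem_tsupport hz, Complex.ofReal_zero, zero_smul]
    let F : (B.system ω₀).ConvAlg := TwistedSystem.ConvAlg.mk F₀ hF₀ hF₀'
    obtain ⟨G, hG, -⟩ := hR F
    refine ⟨fun z => star (G z), G.continuous.star, ?_⟩
    filter_upwards [ρ.eventuallyEq_one] with z hz q
    have h1 := hG z q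
    have h2 : (F z : Euc d →ᵇ ℂ) q = 1 := by
      change (((ρ z : ℝ) : ℂ) • (1 : Euc d →ᵇ ℂ)) q = 1
      rw [hz]
      simp
    rw [h2, star_one, one_mul, gaugePhase_zpow_neg_two] at h1
    change star ((G z : Euc d →ᵇ ℂ) q) = _
    rw [h1, star_mul, star_star, sq]
  have hmem (z : Euc d) : MemOrbitAlgebra ω₀ fun q => gaugePhase A z q ^ 2 := by
    obtain ⟨m, -, hm⟩ := key z
    exact ⟨m z, (m z).2, hm.self_of_nhds⟩
  have hone : ∀ᶠ z in 𝓝 (0 : Euc d), ∀ q, ‖gaugePhase A z q ^ 2 - 1‖ ≤ 1 / 2 := by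
    obtain ⟨m, hmc, hm⟩ := key 0
    have h0 (q : Euc d) : (m 0 : Euc d →ᵇ ℂ) q = 1 := by
      rw [hm.self_of_nhds q, gaugePhase_eq, segmentIntegral_zero]
      simp
    filter_upwards [hm, Metric.continuousAt_iff'.1 (hmc.continuousAt (x := 0)) (1 / 2)
      (by norm_num)] with z hz hd q
    rw [← hz, ← h0 q]
    exact (norm_coe_sub_coe_le (m z) (m 0) q).trans hd.le
  obtain ⟨δ, hδ, hs⟩ := memOrbitAlgebra_segmentIntegral hω₀ hA two_ne_zero hmem hone
  exact memOrbitAlgebra_gaugePhase_of_segmentIntegral hA hBA hδ hs z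

end Phase

/-! ### Vector potentials with components in the algebra of the orbit -/

section Components

open Filter Topology

variable {d : ℕ} {Ω : Type*} [TopologicalSpace Ω] [CompactSpace Ω]
  [TopologicalSpace.MetrizableSpace Ω] [AddAction (Euc d) Ω] [ContinuousVAdd (Euc d) Ω]
  {B : MagneticField d Ω} {ω₀ : Ω} {A : Euc d → (Euc d →L[ℝ] ℝ)}

theorem apply_eq_sum_single (T : Euc d →L[ℝ] ℝ) (z : Euc d) :
    T z = ∑ i, z i * T (EuclideanSpace.single i (1 : ℝ)) := by
  conv_lhs => rw [← (EuclideanSpace.basisFun (Fin d) ℝ).sum_repr z]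
  simp

/-- Elements of 𝒞 are uniformly continuous, and `A` is a fixed continuous linear function of its
finitely many components. -/
theorem uniformContinuous_of_components
    (h : ∀ i : Fin d, MemOrbitAlgebra ω₀
      fun q => ((A q (EuclideanSpace.single i (1 : ℝ)) : ℝ) : ℂ)) : UniformContinuous A := by
  let Φ : (Fin d → ℝ) →L[ℝ] (Euc d →L[ℝ] ℝ) :=
    ∑ i, (ContinuousLinearMap.proj (R := ℝ) (φ := fun _ : Fin d => ℝ) i).smulRight
      (EuclideanSpace.proj i : Euc d →L[ℝ] ℝ)
  have hΦ : A = fun q => Φ fun i => A q (EuclideanSpace.single i (1 : ℝ)) := by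
    ext q z
    rw [apply_eq_sum_single (A q) z]
    simp [Φ, mul_comm]
  rw [hΦ]
  refine Φ.uniformContinuous.comp (uniformContinuous_pi.2 fun i => ?_)
  exact Complex.uniformContinuous_re.comp (h i).uniformContinuous

theorem memOrbitAlgebra_gaugePhase_of_components
    (h : ∀ i : Fin d, MemOrbitAlgebra ω₀
      fun q => ((A q (EuclideanSpace.single i (1 : ℝ)) : ℝ) : ℂ)) (z : Euc d) :
    MemOrbitAlgebra ω₀ (gaugePhase A z) := by
  simp only [memOrbitAlgebra_iff] at h
  choose f hf using h
  -- The line integral as a function on all of Ω: integrating the translates of the representing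
  -- functions along the segment stays continuous, and on the orbit of `ω₀` it gives the line
  -- integral of `A`.
  have hc : Continuous fun ω : Ω =>
      ∫ s in (0 : ℝ)..1, ∑ i, (z i : ℂ) * f i (-(s • z) +ᵥ ω) := by
    let _ := TopologicalSpace.metrizableSpaceMetric Ω
    refine intervalIntegral.continuous_parametric_intervalIntegral_of_continuous'
      (f := fun (ω : Ω) (s : ℝ) => ∑ i, (z i : ℂ) * f i (-(s • z) +ᵥ ω)) ?_ 0 1
    fun_prop
  refine memOrbitAlgebra_iff.2 ⟨⟨fun ω => Complex.exp (-Complex.I *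
    ∫ s in (0 : ℝ)..1, ∑ i, (z i : ℂ) * f i (-(s • z) +ᵥ ω)), by fun_prop⟩, fun q => ?_⟩
  rw [ContinuousMap.coe_mk, gaugePhase_eq, segmentIntegral, ← intervalIntegral.integral_ofReal]
  congr 2
  refine intervalIntegral.integral_congr fun s _ => ?_
  simp only
  rw [apply_eq_sum_single]
  push_cast
  refine Finset.sum_congr rfl fun i _ => ?_
  rw [← hf, ← add_vadd]
  congr 3
  abel

/-- Dividing the line integral along `t • v` by `t` gives the mean of `A · v` over a short segment,
which is uniformly close to its value at the starting point. Closedness of 𝒞 finishes. -/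
theorem memOrbitAlgebra_component (hA : UniformContinuous A) {δ : ℝ} (hδ : 0 < δ)
    (h : ∀ z : Euc d, ‖z‖ < δ → MemOrbitAlgebra ω₀ fun q => (segmentIntegral A z q : ℂ))
    (v : Euc d) : MemOrbitAlgebra ω₀ fun q => ((A q v : ℝ) : ℂ) := by
  have hAv : UniformContinuous fun q => A q v :=
    (ContinuousLinearMap.apply ℝ ℝ v).uniformContinuous.comp hA
  refine MemOrbitAlgebra.of_uniform_limit (Complex.continuous_ofReal.comp hAv.continuous)
    fun ε hε => ?_
  obtain ⟨η, hη, hu⟩ := Metric.uniformContinuous_iff.1 hAv ε hε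
  -- Chosen so that `t • v` is shorter than both `δ` (membership of the line integral) and `η`
  -- (modulus of continuity). The `+ 1` covers `v = 0`.
  let t : ℝ := min δ η / (‖v‖ + 1)
  have hm : 0 < min δ η := lt_min hδ hη
  have hv : 0 < ‖v‖ + 1 := by positivity
  have ht : 0 < t := div_pos hm hv
  have htv : ‖t • v‖ < min δ η := by
    rw [norm_smul, Real.norm_eq_abs, abs_of_pos ht, div_mul_eq_mul_div, div_lt_iff₀ hv]
    exact mul_lt_mul_of_pos_left (lt_add_one _) hm
  have hc : Continuous fun w : ℂ => (t : ℂ)⁻¹ * w := by fun_prop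
  refine ⟨_, (h (t • v) (htv.trans_le (min_le_left _ _))).comp hc, fun q => ?_⟩
  have e1 : t⁻¹ * segmentIntegral A (t • v) q = ∫ s in (0 : ℝ)..1, A (q + s • t • v) v := by
    rw [segmentIntegral, ← intervalIntegral.integral_const_mul]
    refine intervalIntegral.integral_congr fun s _ => ?_
    simp [ht.ne']
  have e2 : t⁻¹ * segmentIntegral A (t • v) q - A q v =
      ∫ s in (0 : ℝ)..1, (A (q + s • t • v) v - A q v) := by
    have hc1 : Continuous fun s : ℝ => A (q + s • t • v) v :=
      hAv.continuous.comp (by fun_prop : Continuous fun s : ℝ => q + s • t • v)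
    rw [intervalIntegral.integral_sub (hc1.intervalIntegrable _ _) (by simp), e1]
    simp
  rw [← Complex.ofReal_inv, ← Complex.ofReal_mul, ← Complex.ofReal_sub, Complex.norm_real, e2]
  have := intervalIntegral.norm_integral_le_of_norm_le_const (a := (0 : ℝ)) (b := 1) (C := ε)
    (f := fun s => A (q + s • t • v) v - A q v) fun s hs => ?_
  · simpa using this
  rw [Set.uIoc_of_le zero_le_one] at hs
  rw [← dist_eq_norm]
  refine (hu ?_).le
  rw [dist_eq_norm, add_sub_cancel_left, norm_smul, Real.norm_eq_abs, abs_of_pos hs.1]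
  exact (mul_le_of_le_one_left (norm_nonneg _) hs.2).trans_lt (htv.trans_le (min_le_right _ _))

end Components

end

theorem mainTheorem10 {d : ℕ} {Ω : Type*} [TopologicalSpace Ω] [CompactSpace Ω]
    [TopologicalSpace.MetrizableSpace Ω] [AddAction (Euc d) Ω] [ContinuousVAdd (Euc d) Ω]
    (ω₀ : Ω) (hω₀ : Dense (Set.range fun x : Euc d => x +ᵥ ω₀))
    (B : MagneticField d Ω) (A : Euc d → (Euc d →L[ℝ] ℝ)) (hA : Continuous A)
    (hBA : IsVectorPotential A (B.fieldAt ω₀)) :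
    (DefinesRealStructure B ω₀ A ↔ ∀ z : Euc d, MemOrbitAlgebra ω₀ (gaugePhase A z)) ∧
    ((∀ i : Fin d, MemOrbitAlgebra ω₀
        fun q => ((A q (EuclideanSpace.single i (1 : ℝ)) : ℝ) : ℂ)) ↔
      UniformContinuous A ∧ ∀ z : Euc d, MemOrbitAlgebra ω₀ (gaugePhase A z)) := by
  refine ⟨⟨fun h => h.memOrbitAlgebra hω₀ hA hBA,
    definesRealStructure_of_memOrbitAlgebra hA hBA⟩, fun h =>
    ⟨uniformContinuous_of_components h, memOrbitAlgebra_gaugePhase_of_components h⟩, ?_⟩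
  rintro ⟨hu, h⟩ i
  -- Here λ itself is in 𝒞, so the power is `k = 1` and closeness to `1` comes from the Baire
  -- argument. Uniform continuity enters only in recovering `A` from its line integrals.
  obtain ⟨δ, hδ, hs⟩ := memOrbitAlgebra_segmentIntegral hω₀ hA one_ne_zero
    (by simpa only [pow_one] using h)
    (by simpa only [pow_one] using
      eventually_norm_gaugePhase_sub_one_le hA hBA h one_half_pos)
  exact memOrbitAlgebra_component hu hδ hs _
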